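/- For $f$ in the Schwartz class $\mathcal S(\mathbb R)$ write $\widehat f(\xi)=\int_{\mathbb R} f(y)e^{-iy\xi}\,dy$ and, for $s\in\mathbb R$, $\|f\|_{H^s(\mathbb R)}=\big(\int_{\mathbb R}(1+\xi^2)^{s}|\widehat f(\xi)|^2\,d\xi\big)^{1/2}$. For $a>1$, $\gamma>0$ and $t>0$ define $$P^t_{a,\gamma}f(x)=\int_{\mathbb R}\widehat f(\xi)\,e^{it|\xi|^a}e^{-t^\gamma|\xi|^a}e^{ix\xi}\,d\xi ,\qquad x\in\mathbb R .$$ Let $s_a(\gamma)$ be the infimum of the set of all $s>0$ for which there is a finite constant $C$, independent of $f$, such that $$\Big\|\sup_{0<t<1}|P^t_{a,\gamma}f|\Big\|_{L^2(\mathbb R)}\le C\,\|f\|_{H^s(\mathbb R)}\qquad\text{for all } f\in\mathcal S(\mathbb R).$$ **Theorem 1.2.** For every $a>1$ and every $\gamma\in(0,\infty)$ this set is non-empty and $$s_a(\gamma)=\frac a4\Big(1-\frac1\gamma\Big)^+,\qquad\text{where } x^+=\max(0,x).$$ -/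

import Mathlib

open MeasureTheory
open scoped SchwartzMap NNReal ENNReal FourierTransform

noncomputable section

namespace ComplexTime

/-- The Fourier transform in angular frequency, `∫ e^{-i y ξ} f(y) dy`. -/
def hat (f : 𝓢(ℝ, ℂ)) (ξ : ℝ) : ℂ :=
  ∫ y : ℝ, Complex.exp (-(Complex.I * y * ξ)) * f y

/-- Comparison with the Fourier transform of Mathlib, whose kernel is `e^{-2 π i y ξ}`. -/
theorem hat_eq_fourier (f : 𝓢(ℝ, ℂ)) (ξ : ℝ) :
    hat f ξ = 𝓕 (f : ℝ → ℂ) (ξ / (2 * Real.pi)) := by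
  rw [Real.fourier_real_eq_integral_exp_smul]
  unfold hat
  congr 1
  funext y
  rw [smul_eq_mul]
  congr 2
  have hpi : (Real.pi : ℂ) ≠ 0 := by exact_mod_cast Real.pi_ne_zero
  push_cast
  field_simp

/-- `P^t_{a,γ} f(x) = ∫ f^(ξ) e^{i t |ξ|^a} e^{-t^γ |ξ|^a} e^{i x ξ} dξ`. -/
def P (a γ t : ℝ) (f : 𝓢(ℝ, ℂ)) (x : ℝ) : ℂ :=
  ∫ ξ : ℝ, hat f ξ * Complex.exp (Complex.I * ((t * |ξ| ^ a : ℝ) : ℂ)) *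
    ((Real.exp (-(t ^ γ * |ξ| ^ a)) : ℝ) : ℂ) * Complex.exp (Complex.I * x * ξ)

/-- The maximal function `sup_{0 < t < 1} |P^t_{a,γ} f(x)|`, with values in `[0, ∞]`. -/
def maximalP (a γ : ℝ) (f : 𝓢(ℝ, ℂ)) (x : ℝ) : ℝ≥0∞ :=
  ⨆ t ∈ Set.Ioo (0 : ℝ) 1, ‖P a γ t f x‖ₑ

/-- The norm of the inhomogeneous Sobolev space `H^s(ℝ)`: the `L²` norm of
`(1 + ξ²)^{s/2} f^(ξ)`. -/
def sobolevNorm (s : ℝ) (f : 𝓢(ℝ, ℂ)) : ℝ≥0∞ :=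
  eLpNorm (fun ξ : ℝ => (((1 + ξ ^ 2) ^ (s / 2) : ℝ) : ℂ) * hat f ξ) 2 volume

/-- The global maximal estimate `‖sup_{0 < t < 1} |P^t_{a,γ} f|‖_{L²(ℝ)} ≤ C ‖f‖_{H^s(ℝ)}` for all
Schwartz functions `f`, with a finite constant `C` that does not depend on `f`. -/
def MaximalEstimate (a γ s : ℝ) : Prop :=
  ∃ C : ℝ≥0, ∀ f : 𝓢(ℝ, ℂ),
    eLpNorm (maximalP a γ f) 2 volume ≤ (C : ℝ≥0∞) * sobolevNorm s f

end ComplexTime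

end

namespace ComplexTime

open scoped ComplexConjugate

/-! At frequency `N` the damping `e^{-t^γ |ξ|^a}` makes times beyond `N^{-a/γ}` negligible. During
that time a packet travels about `N^{a-1-a/γ}`, which is `N^{a(1-1/γ)}` in units of the wavelength
`1/N`. This number `B` governs both directions.

Upper bound. A measurable choice of time `τ(x)` makes the maximal operator linear
(`lintegral_iSup_sq_le_of_linearized`), and `T T*` reduces its `L²` bound to the size of a kernel
(`lintegral_enorm_sq_le_of_kernel`). After rescaling the frequency to size one, the kernel is `osc a
p q y`, with `p` the time difference, `q` the total damping and `y` the rescaled distance, and `|p|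
≤ q^{1/γ} B`. If `|y|` dominates `|p|`, two integrations by parts give decay `y^{-2}`. Otherwise the
second derivative test gives `|p|^{-1/2} e^{-q/2}`, and the constraint on `p` turns this into
`|y|^{-1/2} (1 + |y|/B)^{-1}`. The integral of this envelope is at most a constant times `√(max 1
B)`, so the operator norm on an annulus is at most a constant times `max(1, B)^{1/4}`, that is `N^σ`
with `σ = (a/4)(1-1/γ)^+`. Low frequencies are handled by a power series in the time. For `s > σ`
the annuli sum geometrically.

Lower bound. For `γ > 1` a packet with frequencies within `r` of `N` moves rigidly up to time `t₀ =
N^{-a/γ}` if `t₀ N^{a-2} r²` is small. Its maximal function is then at least a multiple of `r` on an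
interval of length `a t₀ N^{a-1}`, while its squared Sobolev norm is at most a multiple of `r
N^{2s}`. The largest admissible `r` forces `s ≥ σ`; for `γ ≤ 1` the condition `s > 0` suffices. -/

/-! ### The `T T*` method. -/

theorem norm_mul_le_sq_add_sq (u v : ℂ) : ‖u‖ * ‖v‖ ≤ (‖u‖ ^ 2 + ‖v‖ ^ 2) / 2 := by
  nlinarith [sq_nonneg (‖u‖ - ‖v‖)]

/-- The `T T*` bound on a set of finite measure. -/
theorem setLIntegral_enorm_sq_le_of_kernel {m : ℝ → ℝ → ℂ} {M k : ℝ → ℝ} {h : ℝ → ℂ} {κ : ℝ}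
    (hm : Measurable (Function.uncurry m)) (hmM : ∀ x ξ, ‖m x ξ‖ ≤ M ξ)
    (hM : MemLp M 2 volume) (hh : MemLp h 2 volume) (hk : Integrable k)
    (hK : ∀ x x', ‖∫ ξ, m x ξ * conj (m x' ξ)‖ ≤ k (x - x'))
    (hκ : 0 < κ) (hkκ : ∫ x, k x ≤ κ) {E : Set ℝ} (hE : volume E ≠ ∞) :
    ∫⁻ x in E, ‖∫ ξ, h ξ * m x ξ‖ₑ ^ 2 ≤ ENNReal.ofReal (κ * ∫ ξ, ‖h ξ‖ ^ 2) := by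
  set μ := volume.restrict E with hμ
  -- Finite measure and the uniform bound `D` on `F` make every double integral below absolutely
  -- convergent, and `∫ ‖F‖²` finite, so that it can be absorbed at the end.
  have : IsFiniteMeasure μ := ⟨by simpa [hμ, lt_top_iff_ne_top] using hE⟩
  set F : ℝ → ℂ := fun x => ∫ ξ, h ξ * m x ξ with hF
  have hk0 : ∀ y, 0 ≤ k y := fun y => (norm_nonneg _).trans (by simpa using hK y 0)
  have hM0 : ∀ ξ, 0 ≤ M ξ := fun ξ => (norm_nonneg _).trans (hmM 0 ξ)
  have hhM : Integrable fun ξ => ‖h ξ‖ * M ξ := hh.norm.integrable_mul hM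
  have hmeas : AEStronglyMeasurable (Function.uncurry fun x ξ => h ξ * m x ξ)
      (μ.prod volume) := by
    refine AEStronglyMeasurable.mul ?_ hm.aestronglyMeasurable
    exact hh.1.comp_snd
  have hFm : AEStronglyMeasurable F μ := hmeas.integral_prod_right'
  set D : ℝ := ∫ ξ, ‖h ξ‖ * M ξ with hD
  have hD0 : 0 ≤ D := integral_nonneg fun ξ => mul_nonneg (norm_nonneg _) (hM0 ξ)
  have hFb : ∀ x, ‖F x‖ ≤ D := by
    intro x
    refine norm_integral_le_of_norm_le hhM (Filter.Eventually.of_forall fun ξ => ?_)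
    rw [norm_mul]
    exact mul_le_mul_of_nonneg_left (hmM x ξ) (norm_nonneg _)
  set G : ℝ → ℂ := fun ξ => ∫ x, conj (F x) * m x ξ ∂μ with hG
  have hGmeas : AEStronglyMeasurable (Function.uncurry fun ξ x => conj (F x) * m x ξ)
      ((volume : Measure ℝ).prod μ) := by
    refine AEStronglyMeasurable.mul ?_ (hm.comp measurable_swap).aestronglyMeasurable
    exact (Complex.continuous_conj.comp_aestronglyMeasurable hFm).comp_snd
  have hGm : AEStronglyMeasurable G volume := hGmeas.integral_prod_right'
  have hGb : ∀ ξ, ‖G ξ‖ ≤ D * M ξ * μ.real Set.univ := by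
    intro ξ
    refine norm_integral_le_of_norm_le_const (Filter.Eventually.of_forall fun x => ?_)
    rw [norm_mul, RCLike.norm_conj]
    exact mul_le_mul (hFb x) (hmM x ξ) (norm_nonneg _) hD0
  have hGL : MemLp G 2 volume := by
    refine MemLp.of_le (hM.const_mul (D * μ.real Set.univ)) hGm (Filter.Eventually.of_forall fun ξ => ?_)
    refine (hGb ξ).trans ((le_abs_self _).trans_eq ?_)
    rw [Real.norm_eq_abs]; congr 1; ring
  -- the square function as a pairing
  have h1 : ∫ x, ‖F x‖ ^ 2 ∂μ ≤ ∫ ξ, ‖h ξ‖ * ‖G ξ‖ := by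
    have e1 : ((∫ x, ‖F x‖ ^ 2 ∂μ : ℝ) : ℂ) = ∫ ξ, h ξ * G ξ := by
      rw [← integral_complex_ofReal]
      have : ∀ x, ((‖F x‖ ^ 2 : ℝ) : ℂ) = ∫ ξ, conj (F x) * (h ξ * m x ξ) := by
        intro x
        rw [integral_const_mul, ← Complex.normSq_eq_norm_sq, Complex.normSq_eq_conj_mul_self]
      simp_rw [this]
      rw [integral_integral_swap]
      · congr 1; funext ξ
        rw [hG, ← integral_const_mul]
        congr 1; funext x; ring
      · have hb : Integrable (fun z : ℝ × ℝ => D * (‖h z.2‖ * M z.2)) (μ.prod volume) :=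
          (hhM.comp_snd μ).const_mul D
        refine hb.mono' ?_ (Filter.Eventually.of_forall fun z => ?_)
        · exact ((Complex.continuous_conj.comp_aestronglyMeasurable hFm).comp_fst).mul hmeas
        · simp only [Function.uncurry, norm_mul, RCLike.norm_conj]
          exact mul_le_mul (hFb _) (mul_le_mul_of_nonneg_left (hmM _ _) (norm_nonneg _))
            (by positivity) hD0
    have h2 : ‖((∫ x, ‖F x‖ ^ 2 ∂μ : ℝ) : ℂ)‖ = ∫ x, ‖F x‖ ^ 2 ∂μ := by
      rw [Complex.norm_real, Real.norm_of_nonneg]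
      exact integral_nonneg fun x => by positivity
    rw [← h2, e1]
    refine (norm_integral_le_integral_norm _).trans_eq ?_
    simp_rw [norm_mul]
  -- the dual estimate
  have h2 : ∫ ξ, ‖G ξ‖ ^ 2 ≤ κ * ∫ x, ‖F x‖ ^ 2 ∂μ := by
    set ν := μ.prod μ with hν
    have e1 : ((∫ ξ, ‖G ξ‖ ^ 2 : ℝ) : ℂ)
        = ∫ z, conj (F z.1) * F z.2 * (∫ ξ, m z.1 ξ * conj (m z.2 ξ)) ∂ν := by
      rw [← integral_complex_ofReal]
      have : ∀ ξ, ((‖G ξ‖ ^ 2 : ℝ) : ℂ) =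
          ∫ z, (conj (F z.1) * m z.1 ξ) * (F z.2 * conj (m z.2 ξ)) ∂ν := by
        intro ξ
        rw [integral_prod_mul (fun x => conj (F x) * m x ξ) (fun x => F x * conj (m x ξ)),
          ← Complex.normSq_eq_norm_sq, ← Complex.mul_conj, ← integral_conj]
        simp [hG]
      simp_rw [this]
      rw [integral_integral_swap]
      · congr 1; funext z
        rw [← integral_const_mul]
        congr 1; funext ξ; ring
      · have hb : Integrable (fun z : ℝ × (ℝ × ℝ) => D ^ 2 * (M z.1) ^ 2)
            ((volume : Measure ℝ).prod ν) :=
          ((hM.integrable_sq).comp_fst ν).const_mul (D ^ 2)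
        refine hb.mono' ?_ (Filter.Eventually.of_forall fun z => ?_)
        · have hF1 : AEStronglyMeasurable (fun z : ℝ × (ℝ × ℝ) => F z.2.1)
              ((volume : Measure ℝ).prod ν) := (hFm.comp_fst (ν := μ)).comp_snd
          have hF2 : AEStronglyMeasurable (fun z : ℝ × (ℝ × ℝ) => F z.2.2)
              ((volume : Measure ℝ).prod ν) := (hFm.comp_snd (μ := μ)).comp_snd
          have hm1 : Measurable fun z : ℝ × (ℝ × ℝ) => m z.2.1 z.1 :=
            hm.comp ((measurable_fst.comp measurable_snd).prodMk measurable_fst)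
          have hm2 : Measurable fun z : ℝ × (ℝ × ℝ) => m z.2.2 z.1 :=
            hm.comp ((measurable_snd.comp measurable_snd).prodMk measurable_fst)
          exact ((Complex.continuous_conj.comp_aestronglyMeasurable hF1).mul
            hm1.aestronglyMeasurable).mul (hF2.mul
            (Complex.continuous_conj.comp_aestronglyMeasurable hm2.aestronglyMeasurable))
        · simp only [Function.uncurry, norm_mul, RCLike.norm_conj]
          calc _ ≤ (D * M z.1) * (D * M z.1) := by
                gcongr <;> first | exact hFb _ | exact hmM _ _ | exact mul_nonneg hD0 (hM0 _)
            _ = _ := by ring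
    have hFsq : AEMeasurable (fun x => ENNReal.ofReal (‖F x‖ ^ 2)) μ :=
      (hFm.norm.aemeasurable.pow_const 2).ennreal_ofReal
    have hkm : AEMeasurable (fun z : ℝ × ℝ => ENNReal.ofReal (k (z.1 - z.2))) ν := by
      have := (hk.1.aemeasurable.ennreal_ofReal).comp_quasiMeasurePreserving
        (quasiMeasurePreserving_sub (volume : Measure ℝ) volume)
      exact this.mono_ac (Measure.AbsolutelyContinuous.prod
        Measure.restrict_le_self.absolutelyContinuous Measure.restrict_le_self.absolutelyContinuous)
    have hkint : ∫⁻ x, ENNReal.ofReal (k x) ≤ ENNReal.ofReal κ := by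
      rw [← ofReal_integral_eq_lintegral_ofReal hk (Filter.Eventually.of_forall hk0)]
      exact ENNReal.ofReal_le_ofReal hkκ
    have hk1 : ∀ x, ∫⁻ x', ENNReal.ofReal (k (x - x')) ∂μ ≤ ENNReal.ofReal κ := fun x =>
      (setLIntegral_le_lintegral _ _).trans
        ((lintegral_sub_left_eq_self (fun y => ENNReal.ofReal (k y)) x).trans_le hkint)
    have hk2 : ∀ x', ∫⁻ x, ENNReal.ofReal (k (x - x')) ∂μ ≤ ENNReal.ofReal κ := fun x' =>
      (setLIntegral_le_lintegral _ _).trans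
        ((lintegral_sub_right_eq_self (fun y => ENNReal.ofReal (k y)) x').trans_le hkint)
    have hS : ∫⁻ x, ENNReal.ofReal (‖F x‖ ^ 2) ∂μ = ENNReal.ofReal (∫ x, ‖F x‖ ^ 2 ∂μ) := by
      rw [ofReal_integral_eq_lintegral_ofReal _ (Filter.Eventually.of_forall fun x => by positivity)]
      refine Integrable.of_bound (hFm.norm.pow 2) (D ^ 2) (Filter.Eventually.of_forall fun x => ?_)
      rw [norm_pow, norm_norm]
      exact pow_le_pow_left₀ (norm_nonneg _) (hFb x) 2
    have hq1 : AEMeasurable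
        (fun z : ℝ × ℝ => ENNReal.ofReal (‖F z.1‖ ^ 2) * ENNReal.ofReal (k (z.1 - z.2))) ν :=
      hFsq.comp_fst.mul hkm
    have hq2 : AEMeasurable
        (fun z : ℝ × ℝ => ENNReal.ofReal (‖F z.2‖ ^ 2) * ENNReal.ofReal (k (z.1 - z.2))) ν :=
      hFsq.comp_snd.mul hkm
    have p1 : ∫⁻ z, ENNReal.ofReal (‖F z.1‖ ^ 2) * ENNReal.ofReal (k (z.1 - z.2)) ∂ν
        ≤ ENNReal.ofReal κ * ENNReal.ofReal (∫ x, ‖F x‖ ^ 2 ∂μ) := by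
      rw [lintegral_prod _ hq1, ← hS]
      rw [mul_comm, ← lintegral_mul_const' _ _ ENNReal.ofReal_ne_top]
      refine lintegral_mono fun x => ?_
      dsimp only
      rw [lintegral_const_mul' _ _ ENNReal.ofReal_ne_top]
      exact mul_le_mul_right (hk1 x) _
    have p2 : ∫⁻ z, ENNReal.ofReal (‖F z.2‖ ^ 2) * ENNReal.ofReal (k (z.1 - z.2)) ∂ν
        ≤ ENNReal.ofReal κ * ENNReal.ofReal (∫ x, ‖F x‖ ^ 2 ∂μ) := by
      rw [lintegral_prod_symm _ hq2, ← hS]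
      rw [mul_comm, ← lintegral_mul_const' _ _ ENNReal.ofReal_ne_top]
      refine lintegral_mono fun x => ?_
      dsimp only
      rw [lintegral_const_mul' _ _ ENNReal.ofReal_ne_top]
      exact mul_le_mul_right (hk2 x) _
    -- Schur's test: `2 ‖F x‖ ‖F x'‖ ≤ ‖F x‖² + ‖F x'‖²` splits the double integral into `p1` and
    -- `p2`, in each of which one variable meets only the kernel.
    have hkey : ENNReal.ofReal (∫ ξ, ‖G ξ‖ ^ 2) * 2
        ≤ ENNReal.ofReal (κ * ∫ x, ‖F x‖ ^ 2 ∂μ) * 2 := by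
      have hn : ENNReal.ofReal (∫ ξ, ‖G ξ‖ ^ 2) = ‖((∫ ξ, ‖G ξ‖ ^ 2 : ℝ) : ℂ)‖ₑ := by
        rw [← ofReal_norm, Complex.norm_real, Real.norm_of_nonneg]
        exact integral_nonneg fun x => by positivity
      rw [hn, e1, ENNReal.ofReal_mul hκ.le]
      refine (mul_le_mul_left (enorm_integral_le_lintegral_enorm _) 2).trans ?_
      rw [mul_two (ENNReal.ofReal κ * _), ← lintegral_mul_const' _ _ (by simp)]
      refine le_trans ?_ (add_le_add p1 p2)
      rw [← lintegral_add_left' hq1]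
      refine lintegral_mono fun z => ?_
      dsimp only
      rw [← add_mul, ← ENNReal.ofReal_add (by positivity) (by positivity), ← ofReal_norm,
        show (2 : ℝ≥0∞) = ENNReal.ofReal 2 by simp, ← ENNReal.ofReal_mul (by positivity),
        ← ENNReal.ofReal_mul (by positivity)]
      refine ENNReal.ofReal_le_ofReal ?_
      rw [norm_mul, norm_mul, RCLike.norm_conj]
      have := norm_mul_le_sq_add_sq (F z.1) (F z.2)
      have h3 := mul_le_mul this (hK z.1 z.2) (norm_nonneg _) (by positivity)
      linarith
    have h0 : 0 ≤ κ * ∫ x, ‖F x‖ ^ 2 ∂μ :=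
      mul_nonneg hκ.le (integral_nonneg fun x => by positivity)
    have := (ENNReal.mul_le_mul_iff_left (by simp) (by simp)).1 hkey
    exact (ENNReal.ofReal_le_ofReal_iff h0).1 this
  -- The weights in this Young inequality are chosen so that, by `h2`, the `G` term is at most half
  -- of `∫ ‖F‖²`.
  have h3 : ∫ ξ, ‖h ξ‖ * ‖G ξ‖ ≤ ∫ ξ, (κ / 2 * ‖h ξ‖ ^ 2 + (2 * κ)⁻¹ * ‖G ξ‖ ^ 2) := by
    refine integral_mono (hh.norm.integrable_mul hGL.norm)
      ((hh.norm.integrable_sq.const_mul _).add (hGL.norm.integrable_sq.const_mul _)) fun ξ => ?_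
    have : κ / 2 * ‖h ξ‖ ^ 2 + (2 * κ)⁻¹ * ‖G ξ‖ ^ 2 - ‖h ξ‖ * ‖G ξ‖
        = (2 * κ)⁻¹ * (κ * ‖h ξ‖ - ‖G ξ‖) ^ 2 := by
      field_simp; ring
    have h0 : 0 ≤ (2 * κ)⁻¹ * (κ * ‖h ξ‖ - ‖G ξ‖) ^ 2 := by positivity
    dsimp only
    linarith
  rw [integral_add (hh.norm.integrable_sq.const_mul _) (hGL.norm.integrable_sq.const_mul _),
    integral_const_mul, integral_const_mul] at h3
  have h4 : (2 * κ)⁻¹ * ∫ ξ, ‖G ξ‖ ^ 2 ≤ (2 * κ)⁻¹ * (κ * ∫ x, ‖F x‖ ^ 2 ∂μ) :=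
    mul_le_mul_of_nonneg_left h2 (by positivity)
  have h5 : (2 * κ)⁻¹ * (κ * ∫ x, ‖F x‖ ^ 2 ∂μ) = (∫ x, ‖F x‖ ^ 2 ∂μ) / 2 := by field_simp
  have h6 : ∫ x, ‖F x‖ ^ 2 ∂μ ≤ κ * ∫ ξ, ‖h ξ‖ ^ 2 := by linarith
  refine le_trans (le_of_eq ?_) (ENNReal.ofReal_le_ofReal h6)
  rw [ofReal_integral_eq_lintegral_ofReal _ (Filter.Eventually.of_forall fun x => by positivity)]
  · refine lintegral_congr fun x => ?_
    rw [← ofReal_norm, ENNReal.ofReal_pow (norm_nonneg _)]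
  · refine Integrable.of_bound (hFm.norm.pow 2) (D ^ 2) (Filter.Eventually.of_forall fun x => ?_)
    rw [norm_pow, norm_norm]
    exact pow_le_pow_left₀ (norm_nonneg _) (hFb x) 2

/-- The `T T*` bound: an operator whose `T T*` kernel is dominated by an integrable convolution
kernel is bounded on `L²`. -/
theorem lintegral_enorm_sq_le_of_kernel {m : ℝ → ℝ → ℂ} {M k : ℝ → ℝ} {h : ℝ → ℂ} {κ : ℝ}
    (hm : Measurable (Function.uncurry m)) (hmM : ∀ x ξ, ‖m x ξ‖ ≤ M ξ)
    (hM : MemLp M 2 volume) (hh : MemLp h 2 volume) (hk : Integrable k)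
    (hK : ∀ x x', ‖∫ ξ, m x ξ * conj (m x' ξ)‖ ≤ k (x - x'))
    (hκ : 0 < κ) (hkκ : ∫ x, k x ≤ κ) :
    ∫⁻ x, ‖∫ ξ, h ξ * m x ξ‖ₑ ^ 2 ≤ ENNReal.ofReal κ * ∫⁻ ξ, ‖h ξ‖ₑ ^ 2 := by
  have e : ENNReal.ofReal (κ * ∫ ξ, ‖h ξ‖ ^ 2) = ENNReal.ofReal κ * ∫⁻ ξ, ‖h ξ‖ₑ ^ 2 := by
    rw [ENNReal.ofReal_mul hκ.le, ofReal_integral_eq_lintegral_ofReal hh.norm.integrable_sq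
      (Filter.Eventually.of_forall fun x => by positivity)]
    congr 1
    refine lintegral_congr fun x => ?_
    rw [← ofReal_norm, ENNReal.ofReal_pow (norm_nonneg _)]
  -- The local bound does not depend on `E`, so it passes to the limit along an exhaustion by sets
  -- of finite measure.
  rw [← e, ← setLIntegral_univ, ← iUnion_spanningSets (volume : Measure ℝ),
    setLIntegral_iUnion_of_directed _ (monotone_spanningSets (volume : Measure ℝ)).directed_le]
  exact iSup_le fun n => setLIntegral_enorm_sq_le_of_kernel hm hmM hM hh hk hK hκ hkκ
    (measure_spanningSets_lt_top _ n).ne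

/-! ### Oscillatory integrals: stationary and non-stationary phase. -/

open Set

/-- Van der Corput's second derivative test, for an amplitude that vanishes at the end points. -/
theorem norm_integral_mul_exp_le_of_second_deriv {α β δ K : ℝ} (hαβ : α ≤ β) (hδ : 0 < δ)
    {Φ u u' A A' : ℝ → ℝ}
    (hΦ : ∀ η ∈ Icc α β, HasDerivAt Φ (u η) η) (hu : ∀ η ∈ Icc α β, HasDerivAt u (u' η) η)
    (hu' : ContinuousOn u' (Icc α β)) (hδu : ∀ η ∈ Icc α β, δ ^ 2 ≤ u' η)
    (hA : ∀ η ∈ Icc α β, HasDerivAt A (A' η) η) (hA' : ContinuousOn A' (Icc α β))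
    (hAK : ∀ η ∈ Icc α β, |A η| ≤ K) (hA'K : ∀ η ∈ Icc α β, |A' η| ≤ K)
    (hα : A α = 0) (hβ : A β = 0) :
    ‖∫ η in α..β, (A η : ℂ) * Complex.exp (Complex.I * Φ η)‖
      ≤ K * ((β - α) / 2 + 2 * Real.pi) / δ := by
  have hK : 0 ≤ K := (abs_nonneg _).trans (hAK α ⟨le_rfl, hαβ⟩)
  have hpos : ∀ η, 0 < u η ^ 2 + δ ^ 2 := fun η => by positivity
  have huIcc : uIcc α β = Icc α β := uIcc_of_le hαβ
  -- Integration by parts would divide by the phase derivative `u`. Replacing `1/u` by `u/(u² + δ²)`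
  -- keeps the quotient below `1/(2δ)` and avoids splitting the interval near a zero of `u`. The
  -- price is the extra term `δ²/(u² + δ²)` in `rem`.
  set g : ℝ → ℝ := fun η => u η / (u η ^ 2 + δ ^ 2) with hg
  set g' : ℝ → ℝ := fun η => u' η * (δ ^ 2 - u η ^ 2) / (u η ^ 2 + δ ^ 2) ^ 2 with hg'
  set E : ℝ → ℂ := fun η => Complex.exp (Complex.I * Φ η) with hE
  set rem : ℝ → ℂ := fun η => (Complex.I * (A' η * g η + A η * g' η) +
    A η * (δ ^ 2 / (u η ^ 2 + δ ^ 2))) * E η with hrem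
  have hEn : ∀ η, ‖E η‖ = 1 := fun η => by rw [hE]; simp [Complex.norm_exp]
  have hgd : ∀ η ∈ Icc α β, HasDerivAt g (g' η) η := by
    intro η hη
    have := (hu η hη).div (((hu η hη).pow 2).add_const (δ ^ 2)) (hpos η).ne'
    refine HasDerivAt.congr_deriv this ?_
    simp only [hg', Pi.pow_apply]
    congr 1
    push_cast; ring
  have hEd : ∀ η ∈ Icc α β, HasDerivAt E (E η * (Complex.I * u η)) η := by
    intro η hη
    exact ((hΦ η hη).ofReal_comp.const_mul Complex.I).cexp
  have hcu : ContinuousOn u (Icc α β) := fun η hη => (hu η hη).continuousAt.continuousWithinAt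
  have hcA : ContinuousOn A (Icc α β) := fun η hη => (hA η hη).continuousAt.continuousWithinAt
  have hcg : ContinuousOn g (Icc α β) := fun η hη => (hgd η hη).continuousAt.continuousWithinAt
  have hcE : ContinuousOn E (Icc α β) := fun η hη => (hEd η hη).continuousAt.continuousWithinAt
  have hcg' : ContinuousOn g' (Icc α β) :=
    (hu'.mul (continuousOn_const.sub (hcu.pow 2))).div ((hcu.pow 2).add continuousOn_const |>.pow 2)
      fun η _ => by have := hpos η; positivity
  have hcd : ContinuousOn (fun η => δ ^ 2 / (u η ^ 2 + δ ^ 2)) (Icc α β) :=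
    continuousOn_const.div ((hcu.pow 2).add continuousOn_const) fun η _ => (hpos η).ne'
  have hcd' : ContinuousOn (fun η => u' η / (u η ^ 2 + δ ^ 2)) (Icc α β) :=
    hu'.div ((hcu.pow 2).add continuousOn_const) fun η _ => (hpos η).ne'
  have cast : ∀ {v : ℝ → ℝ}, ContinuousOn v (Icc α β) →
      ContinuousOn (fun η => (v η : ℂ)) (Icc α β) := fun hv =>
    Complex.continuous_ofReal.comp_continuousOn hv
  have hcrem : ContinuousOn rem (Icc α β) := by
    have h1 := (cast hA').mul (cast hcg)
    have h2 := (cast hcA).mul (cast hcg')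
    have h3 := (cast hcA).mul (cast hcd)
    have := ((continuousOn_const (c := Complex.I)).mul (h1.add h2)).add h3 |>.mul hcE
    refine this.congr fun η _ => ?_
    simp [hrem]
  have hcAE : ContinuousOn (fun η => (A η : ℂ) * E η) (Icc α β) := (cast hcA).mul hcE
  have hV : ∀ η ∈ uIcc α β, HasDerivAt (fun η => -Complex.I * (A η * g η * E η))
      (A η * E η - rem η) η := by
    intro η hη
    rw [huIcc] at hη
    have h := ((((hA η hη).ofReal_comp).mul ((hgd η hη).ofReal_comp)).mul (hEd η hη)).const_mul
      (-Complex.I)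
    refine HasDerivAt.congr_deriv h ?_
    have hne : ((u η : ℂ) ^ 2 + (δ : ℂ) ^ 2) ≠ 0 := by exact_mod_cast (hpos η).ne'
    have key : (g η : ℂ) * u η = 1 - δ ^ 2 / (u η ^ 2 + δ ^ 2) := by
      simp only [hg]; push_cast; field_simp; ring
    simp only [hrem, Pi.mul_apply]
    linear_combination ((A η : ℂ) * E η) * key
      - (A η * g η * E η * u η : ℂ) * Complex.I_mul_I
  have hint := intervalIntegral.integral_eq_sub_of_hasDerivAt hV
    ((hcAE.sub hcrem).intervalIntegrable_of_Icc hαβ)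
  rw [intervalIntegral.integral_sub (hcAE.intervalIntegrable_of_Icc hαβ)
    (hcrem.intervalIntegrable_of_Icc hαβ)] at hint
  simp only [hα, hβ, Complex.ofReal_zero, zero_mul, mul_zero, sub_zero] at hint
  rw [sub_eq_zero.1 hint]
  have hgb : ∀ η, |g η| ≤ 1 / (2 * δ) := by
    intro η
    rw [hg]
    simp only
    rw [abs_div, abs_of_pos (hpos η), div_le_div_iff₀ (hpos η) (by positivity)]
    have := sq_nonneg (|u η| - δ)
    have h2 := sq_abs (u η)
    nlinarith
  have hg'b : ∀ η ∈ Icc α β, |g' η| ≤ u' η / (u η ^ 2 + δ ^ 2) := by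
    intro η hη
    have h0 : 0 ≤ u' η := (sq_nonneg δ).trans (hδu η hη)
    rw [hg']
    simp only
    rw [abs_div, abs_mul, abs_of_nonneg h0, abs_of_pos (pow_pos (hpos η) 2),
      div_le_div_iff₀ (pow_pos (hpos η) 2) (hpos η)]
    have : |δ ^ 2 - u η ^ 2| ≤ u η ^ 2 + δ ^ 2 := by
      rw [abs_le]; constructor <;> nlinarith [sq_nonneg δ, sq_nonneg (u η)]
    calc _ ≤ u' η * (u η ^ 2 + δ ^ 2) * (u η ^ 2 + δ ^ 2) := by gcongr
      _ = _ := by ring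
  have hremb : ∀ η ∈ Icc α β, ‖rem η‖ ≤ K / (2 * δ) + 2 * K * (u' η / (u η ^ 2 + δ ^ 2)) := by
    intro η hη
    have h0 : δ ^ 2 / (u η ^ 2 + δ ^ 2) ≤ u' η / (u η ^ 2 + δ ^ 2) :=
      div_le_div_of_nonneg_right (hδu η hη) (hpos η).le
    have e1 : ‖((A' η : ℂ) * g η)‖ ≤ K * (1 / (2 * δ)) := by
      rw [norm_mul, Complex.norm_real, Complex.norm_real]
      exact mul_le_mul (hA'K η hη) (hgb η) (norm_nonneg _) hK
    have e2 : ‖((A η : ℂ) * g' η)‖ ≤ K * (u' η / (u η ^ 2 + δ ^ 2)) := by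
      rw [norm_mul, Complex.norm_real, Complex.norm_real]
      exact mul_le_mul (hAK η hη) (hg'b η hη) (norm_nonneg _) hK
    have e3 : ‖((A η : ℂ) * (δ ^ 2 / (u η ^ 2 + δ ^ 2)))‖ ≤ K * (u' η / (u η ^ 2 + δ ^ 2)) := by
      have : ((A η : ℂ) * (δ ^ 2 / (u η ^ 2 + δ ^ 2))) =
        ((A η * (δ ^ 2 / (u η ^ 2 + δ ^ 2)) : ℝ) : ℂ) := by push_cast; ring
      rw [this, Complex.norm_real, norm_mul]
      refine mul_le_mul (hAK η hη) ?_ (norm_nonneg _) hK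
      rw [Real.norm_of_nonneg (div_nonneg (sq_nonneg _) (hpos η).le)]
      exact h0
    rw [hrem]
    simp only
    rw [norm_mul, hEn, mul_one]
    refine (norm_add_le _ _).trans ?_
    rw [norm_mul, Complex.norm_I, one_mul]
    have := norm_add_le ((A' η : ℂ) * g η) (A η * g' η)
    have e4 : K * (1 / (2 * δ)) = K / (2 * δ) := by ring
    linarith
  -- Since `δ² ≤ u'`, both the error term and `|g'|` are at most `u'/(u² + δ²)`. This is an exact
  -- derivative of an arctangent, so its integral is at most `π/δ` however large `u` is.
  have hV' : ∀ η ∈ uIcc α β, HasDerivAt (fun η => δ⁻¹ * Real.arctan (u η / δ))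
      (u' η / (u η ^ 2 + δ ^ 2)) η := by
    intro η hη
    rw [huIcc] at hη
    have := (((hu η hη).div_const δ).arctan).const_mul δ⁻¹
    refine HasDerivAt.congr_deriv this ?_
    field_simp
    ring
  have hi2 := intervalIntegral.integral_eq_sub_of_hasDerivAt hV'
    (hcd'.intervalIntegrable_of_Icc hαβ)
  have hcb : ContinuousOn (fun η => 2 * K * (u' η / (u η ^ 2 + δ ^ 2))) (Icc α β) :=
    continuousOn_const.mul hcd'
  have hb := intervalIntegral.norm_integral_le_of_norm_le (μ := volume) hαβ
    (Filter.Eventually.of_forall fun η (hη : η ∈ Ioc α β) => hremb η ⟨hη.1.le, hη.2⟩)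
    ((continuousOn_const.add hcb).intervalIntegrable_of_Icc hαβ)
  refine hb.trans ?_
  rw [intervalIntegral.integral_add (by simp)
    (hcb.intervalIntegrable_of_Icc hαβ),
    intervalIntegral.integral_const_mul, hi2, intervalIntegral.integral_const, smul_eq_mul]
  have a1 := Real.arctan_lt_pi_div_two (u β / δ)
  have a2 := Real.neg_pi_div_two_lt_arctan (u α / δ)
  have a3 : δ⁻¹ * Real.arctan (u β / δ) - δ⁻¹ * Real.arctan (u α / δ) ≤ δ⁻¹ * Real.pi := by
    rw [← mul_sub]
    exact mul_le_mul_of_nonneg_left (by linarith) (by positivity)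
  calc _ ≤ (β - α) * (K / (2 * δ)) + 2 * K * (δ⁻¹ * Real.pi) := by gcongr
    _ = _ := by field_simp

/-- Two integrations by parts against a complex phase without stationary points. -/
theorem norm_integral_mul_exp_le_of_deriv_ge {α β R c : ℝ} (hαβ : α ≤ β) (hR : 0 < R) (hc : 1 ≤ c)
    {Λ Λ₁ Λ₂ Λ₃ : ℝ → ℂ} {Ψ Ψ₁ Ψ₂ : ℝ → ℝ}
    (h0 : ∀ η ∈ Icc α β, HasDerivAt Λ (Λ₁ η) η) (h1 : ∀ η ∈ Icc α β, HasDerivAt Λ₁ (Λ₂ η) η)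
    (h2 : ∀ η ∈ Icc α β, HasDerivAt Λ₂ (Λ₃ η) η) (h3 : ContinuousOn Λ₃ (Icc α β))
    (k0 : ∀ η ∈ Icc α β, HasDerivAt Ψ (Ψ₁ η) η) (k1 : ∀ η ∈ Icc α β, HasDerivAt Ψ₁ (Ψ₂ η) η)
    (k2 : ContinuousOn Ψ₂ (Icc α β))
    (hre : ∀ η ∈ Icc α β, (Λ η).re ≤ 0)
    (b1 : ∀ η ∈ Icc α β, R ≤ c * ‖Λ₁ η‖) (b2 : ∀ η ∈ Icc α β, ‖Λ₂ η‖ ≤ c * R)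
    (b3 : ∀ η ∈ Icc α β, ‖Λ₃ η‖ ≤ c * R)
    (d0 : ∀ η ∈ Icc α β, |Ψ η| ≤ c) (d1 : ∀ η ∈ Icc α β, |Ψ₁ η| ≤ c)
    (d2 : ∀ η ∈ Icc α β, |Ψ₂ η| ≤ c)
    (e0 : Ψ α = 0) (e1 : Ψ β = 0) (e2 : Ψ₁ α = 0) (e3 : Ψ₁ β = 0) :
    ‖∫ η in α..β, (Ψ η : ℂ) * Complex.exp (Λ η)‖ ≤ 8 * c ^ 7 * (β - α) / R ^ 2 := by
  have hc0 : 0 < c := by linarith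
  have huIcc : uIcc α β = Icc α β := uIcc_of_le hαβ
  have hne : ∀ η ∈ Icc α β, Λ₁ η ≠ 0 := fun η hη h => by
    have := b1 η hη
    rw [h, norm_zero, mul_zero] at this
    linarith
  set L : ℝ → ℂ := fun η => (Λ₁ η)⁻¹ with hL
  set E : ℝ → ℂ := fun η => Complex.exp (Λ η) with hE
  -- `Z = ((Ψ L)' L)'` is the amplitude left after two integrations by parts. Its coefficients 1, 3,
  -- 1, 3 add up to the 8 of the statement, and its worst term is `c (cR)² (c/R)⁴ = c⁷/R²`.
  set Z : ℝ → ℂ := fun η => Ψ₂ η * L η ^ 2 - 3 * (Ψ₁ η * Λ₂ η * L η ^ 3) - Ψ η * Λ₃ η * L η ^ 3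
    + 3 * (Ψ η * Λ₂ η ^ 2 * L η ^ 4) with hZ
  have hLd : ∀ η ∈ Icc α β, HasDerivAt L (-(Λ₂ η) * L η ^ 2) η := by
    intro η hη
    have := (h1 η hη).fun_inv (hne η hη)
    refine HasDerivAt.congr_deriv this ?_
    simp only [hL]; field_simp
  have hEd : ∀ η ∈ Icc α β, HasDerivAt E (E η * Λ₁ η) η := fun η hη => (h0 η hη).cexp
  have cont : ∀ {v v' : ℝ → ℂ}, (∀ η ∈ Icc α β, HasDerivAt v (v' η) η) →
      ContinuousOn v (Icc α β) := fun hv η hη => (hv η hη).continuousAt.continuousWithinAt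
  have k0' : ∀ η ∈ Icc α β, HasDerivAt (fun η => (Ψ η : ℂ)) (Ψ₁ η) η :=
    fun η hη => (k0 η hη).ofReal_comp
  have k1' : ∀ η ∈ Icc α β, HasDerivAt (fun η => (Ψ₁ η : ℂ)) (Ψ₂ η) η :=
    fun η hη => (k1 η hη).ofReal_comp
  have k2' : ContinuousOn (fun η => (Ψ₂ η : ℂ)) (Icc α β) :=
    Complex.continuous_ofReal.comp_continuousOn k2
  have cL := cont hLd
  have cE := cont hEd
  have cZ : ContinuousOn Z (Icc α β) :=
    (((k2'.mul (cL.pow 2)).sub (continuousOn_const.mul (((cont k1').mul (cont h2)).mul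
      (cL.pow 3)))).sub (((cont k0').mul h3).mul (cL.pow 3))).add
      (continuousOn_const.mul (((cont k0').mul ((cont h2).pow 2)).mul (cL.pow 4)))
  have hV : ∀ η ∈ uIcc α β, HasDerivAt
      (fun η => (Ψ η * L η - Ψ₁ η * L η ^ 2 + Ψ η * Λ₂ η * L η ^ 3) * E η)
      (Ψ η * E η - Z η * E η) η := by
    intro η hη
    rw [huIcc] at hη
    have hLη := hLd η hη
    have h := ((((k0' η hη).mul hLη).sub ((k1' η hη).mul (hLη.pow 2))).add
      (((k0' η hη).mul (h2 η hη)).mul (hLη.pow 3))).mul (hEd η hη)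
    refine HasDerivAt.congr_deriv h ?_
    have key : L η * Λ₁ η = 1 := inv_mul_cancel₀ (hne η hη)
    simp only [hZ, Pi.mul_apply, Pi.sub_apply, Pi.add_apply, Pi.pow_apply]
    push_cast
    linear_combination (Ψ η * E η - Ψ₁ η * L η * E η + Ψ η * Λ₂ η * L η ^ 2 * E η : ℂ) * key
  have cΨE : ContinuousOn (fun η => Ψ η * E η) (Icc α β) := (cont k0').mul cE
  have cZE : ContinuousOn (fun η => Z η * E η) (Icc α β) := cZ.mul cE
  have hint := intervalIntegral.integral_eq_sub_of_hasDerivAt hV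
    ((cΨE.sub cZE).intervalIntegrable_of_Icc hαβ)
  rw [intervalIntegral.integral_sub (cΨE.intervalIntegrable_of_Icc hαβ)
    (cZE.intervalIntegrable_of_Icc hαβ)] at hint
  simp only [e0, e1, e2, e3, Complex.ofReal_zero, zero_mul, sub_zero, add_zero] at hint
  rw [sub_eq_zero.1 hint]
  have hb : ∀ η ∈ uIoc α β, ‖Z η * E η‖ ≤ 8 * c ^ 7 / R ^ 2 := by
    intro η hη
    rw [uIoc_of_le hαβ] at hη
    have hη : η ∈ Icc α β := ⟨hη.1.le, hη.2⟩
    have hEn : ‖E η‖ ≤ 1 := by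
      rw [hE]; simp only; rw [Complex.norm_exp, Real.exp_le_one_iff]; exact hre η hη
    have hLn : ‖L η‖ ≤ c / R := by
      simp only [hL, norm_inv]
      have hp : 0 < ‖Λ₁ η‖ := norm_pos_iff.2 (hne η hη)
      rw [inv_le_comm₀ hp (by positivity), inv_div, div_le_iff₀ hc0]
      linarith [b1 η hη]
    have hΨ := d0 η hη
    have hΨ1 := d1 η hη
    have hΨ2 := d2 η hη
    have hl2 := b2 η hη
    have hl3 := b3 η hη
    have hcp : ∀ n, n ≤ 7 → c ^ n ≤ c ^ 7 := fun n hn => pow_le_pow_right₀ hc hn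
    have t1 : ‖(Ψ₂ η * L η ^ 2 : ℂ)‖ ≤ c ^ 7 / R ^ 2 := by
      rw [norm_mul, norm_pow, Complex.norm_real, Real.norm_eq_abs]
      calc _ ≤ c * (c / R) ^ 2 := by gcongr
        _ = c ^ 3 / R ^ 2 := by field_simp
        _ ≤ _ := by gcongr ?_ / _; exact hcp 3 (by norm_num)
    have t2 : ‖(Ψ₁ η * Λ₂ η * L η ^ 3 : ℂ)‖ ≤ c ^ 7 / R ^ 2 := by
      rw [norm_mul, norm_mul, norm_pow, Complex.norm_real, Real.norm_eq_abs]
      calc _ ≤ c * (c * R) * (c / R) ^ 3 := by gcongr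
        _ = c ^ 5 / R ^ 2 := by field_simp
        _ ≤ _ := by gcongr ?_ / _; exact hcp 5 (by norm_num)
    have t3 : ‖(Ψ η * Λ₃ η * L η ^ 3 : ℂ)‖ ≤ c ^ 7 / R ^ 2 := by
      rw [norm_mul, norm_mul, norm_pow, Complex.norm_real, Real.norm_eq_abs]
      calc _ ≤ c * (c * R) * (c / R) ^ 3 := by gcongr
        _ = c ^ 5 / R ^ 2 := by field_simp
        _ ≤ _ := by gcongr ?_ / _; exact hcp 5 (by norm_num)
    have t4 : ‖(Ψ η * Λ₂ η ^ 2 * L η ^ 4 : ℂ)‖ ≤ c ^ 7 / R ^ 2 := by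
      rw [norm_mul, norm_mul, norm_pow, norm_pow, Complex.norm_real, Real.norm_eq_abs]
      calc _ ≤ c * (c * R) ^ 2 * (c / R) ^ 4 := by gcongr
        _ = c ^ 7 / R ^ 2 := by field_simp
    have tZ : ‖Z η‖ ≤ 8 * c ^ 7 / R ^ 2 := by
      simp only [hZ]
      have u1 := norm_add_le (Ψ₂ η * L η ^ 2 - 3 * (Ψ₁ η * Λ₂ η * L η ^ 3)
        - Ψ η * Λ₃ η * L η ^ 3) (3 * (Ψ η * Λ₂ η ^ 2 * L η ^ 4))
      have u2 := norm_sub_le (Ψ₂ η * L η ^ 2 - 3 * (Ψ₁ η * Λ₂ η * L η ^ 3))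
        (Ψ η * Λ₃ η * L η ^ 3)
      have u3 := norm_sub_le (Ψ₂ η * L η ^ 2 : ℂ) (3 * (Ψ₁ η * Λ₂ η * L η ^ 3))
      rw [norm_mul 3, Complex.norm_ofNat] at u1 u3
      have : 8 * c ^ 7 / R ^ 2 = 8 * (c ^ 7 / R ^ 2) := by ring
      rw [this]
      linarith
    rw [norm_mul]
    calc _ ≤ (8 * c ^ 7 / R ^ 2) * 1 := by gcongr
      _ = _ := mul_one _
  have := intervalIntegral.norm_integral_le_of_norm_le_const hb
  rw [abs_of_nonneg (by linarith)] at this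
  exact this.trans_eq (by ring)

/-! ### Pointwise bounds for the normalised kernel. -/

/-- The normalised oscillatory integral with complex time `p + i q`. -/
noncomputable def osc (a p q y : ℝ) : ℂ :=
  ∫ η in (1 : ℝ)..4, ((((η - 1) * (4 - η)) ^ 2 : ℝ) : ℂ) *
    Complex.exp ((Complex.I * p - q) * ((η ^ a : ℝ) : ℂ) + Complex.I * y * η)

/-- The amplitude is a square because `T T*` pairs the cutoff with itself. Its double zeros at 1 and
4 remove the boundary terms of two integrations by parts. -/
theorem abs_cutoff_le {η : ℝ} (hη : η ∈ Icc (1 : ℝ) 4) : |((η - 1) * (4 - η)) ^ 2| ≤ 6 := by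
  have h0 : 0 ≤ (η - 1) * (4 - η) := mul_nonneg (by linarith [hη.1]) (by linarith [hη.2])
  have h1 : (η - 1) * (4 - η) ≤ 9 / 4 := by nlinarith [sq_nonneg (η - 5 / 2)]
  rw [abs_of_nonneg (sq_nonneg _)]
  nlinarith

theorem abs_deriv_cutoff_le {η : ℝ} (hη : η ∈ Icc (1 : ℝ) 4) :
    |2 * ((η - 1) * (4 - η)) * (5 - 2 * η)| ≤ 18 := by
  have h0 : 0 ≤ (η - 1) * (4 - η) := mul_nonneg (by linarith [hη.1]) (by linarith [hη.2])
  have h1 : (η - 1) * (4 - η) ≤ 9 / 4 := by nlinarith [sq_nonneg (η - 5 / 2)]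
  have h2 : |5 - 2 * η| ≤ 3 := by rw [abs_le]; constructor <;> linarith [hη.1, hη.2]
  rw [abs_mul, abs_of_nonneg (by positivity)]
  nlinarith [abs_nonneg (5 - 2 * η)]

theorem abs_deriv_deriv_cutoff_le {η : ℝ} (hη : η ∈ Icc (1 : ℝ) 4) :
    |2 * (5 - 2 * η) ^ 2 - 4 * ((η - 1) * (4 - η))| ≤ 27 := by
  have h0 : 0 ≤ (η - 1) * (4 - η) := mul_nonneg (by linarith [hη.1]) (by linarith [hη.2])
  rw [abs_le]; constructor <;> nlinarith [sq_nonneg (η - 5 / 2)]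

theorem hasDerivAt_cutoff (η : ℝ) : HasDerivAt (fun η : ℝ => ((η - 1) * (4 - η)) ^ 2)
    (2 * ((η - 1) * (4 - η)) * (5 - 2 * η)) η := by
  have := ((((hasDerivAt_id' η).sub_const 1).fun_mul ((hasDerivAt_id' η).const_sub 4))).fun_pow 2
  refine this.congr_deriv ?_
  push_cast; ring

theorem hasDerivAt_deriv_cutoff (η : ℝ) :
    HasDerivAt (fun η : ℝ => 2 * ((η - 1) * (4 - η)) * (5 - 2 * η))
    (2 * (5 - 2 * η) ^ 2 - 4 * ((η - 1) * (4 - η))) η := by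
  have := ((((hasDerivAt_id' η).sub_const 1).fun_mul
    ((hasDerivAt_id' η).const_sub 4)).const_mul 2).fun_mul
      (((hasDerivAt_id' η).const_mul 2).const_sub 5)
  refine this.congr_deriv ?_
  ring

theorem rpow_le_four_rpow {a b η : ℝ} (ha : 0 ≤ a) (hba : b ≤ a) (hη : η ∈ Icc (1 : ℝ) 4) :
    η ^ b ≤ 4 ^ a :=
  (Real.rpow_le_rpow_of_exponent_le hη.1 hba).trans
    (Real.rpow_le_rpow (by linarith [hη.1]) hη.2 ha)

theorem norm_osc_le {a p q y : ℝ} (hq : 0 ≤ q) : ‖osc a p q y‖ ≤ 18 := by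
  have : ∀ η ∈ uIoc (1 : ℝ) 4, ‖((((η - 1) * (4 - η)) ^ 2 : ℝ) : ℂ) *
      Complex.exp ((Complex.I * p - q) * ((η ^ a : ℝ) : ℂ) + Complex.I * y * η)‖ ≤ 6 := by
    intro η hη
    rw [uIoc_of_le (by norm_num)] at hη
    rw [norm_mul, Complex.norm_real, Complex.norm_exp]
    have h1 := abs_cutoff_le (Ioc_subset_Icc_self hη)
    have h0 : 0 ≤ η ^ a := Real.rpow_nonneg (by linarith [hη.1]) _
    have h2 : Real.exp ((Complex.I * p - q) * ((η ^ a : ℝ) : ℂ) + Complex.I * y * η).re ≤ 1 := by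
      rw [Real.exp_le_one_iff]
      simp
      positivity
    calc _ ≤ (6 : ℝ) * 1 := mul_le_mul h1 h2 (Real.exp_pos _).le (by norm_num)
      _ = 6 := by norm_num
  refine (intervalIntegral.norm_integral_le_of_norm_le_const this).trans ?_
  norm_num

theorem conj_osc (a p q y : ℝ) : conj (osc a p q y) = osc a (-p) q (-y) := by
  unfold osc
  rw [intervalIntegral.integral_of_le (by norm_num), intervalIntegral.integral_of_le (by norm_num),
    ← integral_conj]
  congr 1
  funext η
  rw [map_mul, Complex.conj_ofReal, ← Complex.exp_conj]
  congr 2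
  simp

/-- The damping is put into the amplitude, leaving the real phase `p η^a + y η`. Its second
derivative does not see `y` and is at least `p a(a-1)/4`, because `η^{a-2} ≥ 1/4` on `[1, 4]`. Half
of the exponential decay is spent on the factor `q` that appears when the damping is differentiated.
-/
theorem norm_osc_le_of_pos {a p q : ℝ} (ha : 1 < a) (hq : 0 ≤ q) (hp : 0 < p) (y : ℝ) :
    ‖osc a p q y‖ ≤ (18 + 12 * a * 4 ^ a) * (3 / 2 + 2 * Real.pi) / √(a * (a - 1) / 4)
      * ((√p)⁻¹ * Real.exp (-(q / 2))) := by
  have ha0 : 0 < a := by linarith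
  have hδ0 : 0 < a * (a - 1) / 4 := by have : 0 < a - 1 := by linarith
                                       positivity
  -- 18 bounds the derivative of the squared cutoff; `12 = 6 · 2` combines its size with `q e^{-q} ≤
  -- 2 e^{-q/2}`.
  set K : ℝ := (18 + 12 * a * 4 ^ a) * Real.exp (-(q / 2)) with hK
  set δ : ℝ := √(a * (a - 1) / 4) * √p with hδ
  have hδ2 : δ ^ 2 = a * (a - 1) / 4 * p := by
    rw [hδ, mul_pow, Real.sq_sqrt hδ0.le, Real.sq_sqrt hp.le]
  have hpos : ∀ η ∈ Icc (1 : ℝ) 4, 0 < η := fun η hη => by linarith [hη.1]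
  have hΦ : ∀ η ∈ Icc (1 : ℝ) 4,
      HasDerivAt (fun η => p * η ^ a + y * η) (p * (a * η ^ (a - 1)) + y) η := by
    intro η hη
    have := ((Real.hasDerivAt_rpow_const (p := a) (Or.inl (hpos η hη).ne')).const_mul p).fun_add
      ((hasDerivAt_id' η).const_mul y)
    refine this.congr_deriv (by ring)
  have hu : ∀ η ∈ Icc (1 : ℝ) 4,
      HasDerivAt (fun η => p * (a * η ^ (a - 1)) + y) (p * (a * ((a - 1) * η ^ (a - 1 - 1)))) η := by
    intro η hη
    exact (((Real.hasDerivAt_rpow_const (p := a - 1)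
      (Or.inl (hpos η hη).ne')).const_mul a).const_mul p).add_const y
  have hA : ∀ η ∈ Icc (1 : ℝ) 4,
      HasDerivAt (fun η => ((η - 1) * (4 - η)) ^ 2 * Real.exp (-(q * η ^ a)))
      (2 * ((η - 1) * (4 - η)) * (5 - 2 * η) * Real.exp (-(q * η ^ a)) +
        ((η - 1) * (4 - η)) ^ 2 * (Real.exp (-(q * η ^ a)) * -(q * (a * η ^ (a - 1))))) η := by
    intro η hη
    exact (hasDerivAt_cutoff η).fun_mul
      (((Real.hasDerivAt_rpow_const (p := a) (Or.inl (hpos η hη).ne')).const_mul q).fun_neg.exp)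
  have hcr : ∀ b : ℝ, ContinuousOn (fun η : ℝ => η ^ b) (Icc 1 4) := fun b =>
    continuousOn_id.rpow_const fun η hη => Or.inl (hpos η hη).ne'
  have hexp : ∀ η ∈ Icc (1 : ℝ) 4, Real.exp (-(q * η ^ a)) ≤ Real.exp (-q) := by
    intro η hη
    rw [Real.exp_le_exp]
    nlinarith [Real.one_le_rpow hη.1 ha0.le]
  have hexp2 : Real.exp (-q) ≤ Real.exp (-(q / 2)) := Real.exp_le_exp.2 (by linarith)
  have hexp3 : q * Real.exp (-q) ≤ 2 * Real.exp (-(q / 2)) := by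
    have h1 : q / 2 ≤ Real.exp (q / 2) := by linarith [Real.add_one_le_exp (q / 2)]
    have h2 : Real.exp (-q) = Real.exp (-(q / 2)) * Real.exp (-(q / 2)) := by
      rw [← Real.exp_add]; ring_nf
    have h3 : Real.exp (q / 2) * Real.exp (-(q / 2)) = 1 := by rw [← Real.exp_add]; simp
    rw [h2]
    nlinarith [Real.exp_pos (-(q / 2))]
  have h4a : (0 : ℝ) < 4 ^ a := by positivity
  have key := norm_integral_mul_exp_le_of_second_deriv (K := K) (δ := δ) (by norm_num)
    (mul_pos (Real.sqrt_pos.2 hδ0) (Real.sqrt_pos.2 hp)) hΦ hu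
    (continuousOn_const.mul (continuousOn_const.mul (continuousOn_const.mul (hcr _)))) ?_ hA ?_ ?_ ?_
    (by norm_num) (by norm_num)
  · have e : osc a p q y = ∫ η in (1 : ℝ)..4,
        ((((η - 1) * (4 - η)) ^ 2 * Real.exp (-(q * η ^ a)) : ℝ) : ℂ) *
          Complex.exp (Complex.I * ((p * η ^ a + y * η : ℝ) : ℂ)) := by
      unfold osc
      congr 1
      funext η
      rw [Complex.ofReal_mul, mul_assoc (((((η - 1) * (4 - η)) ^ 2 : ℝ)) : ℂ), Complex.ofReal_exp,
        ← Complex.exp_add]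
      congr 2
      push_cast
      ring
    rw [e]
    refine key.trans (le_of_eq ?_)
    have h1 : √p ≠ 0 := (Real.sqrt_pos.2 hp).ne'
    have h2 : √(a * (a - 1) / 4) ≠ 0 := (Real.sqrt_pos.2 hδ0).ne'
    rw [hK, hδ]
    generalize √p = r at *
    generalize √(a * (a - 1) / 4) = r' at *
    field_simp
    ring
  · intro η hη
    rw [hδ2]
    have h1 : 1 / 4 ≤ η ^ (a - 1 - 1) := by
      rw [Real.rpow_sub_one (hpos η hη).ne']
      have := Real.one_le_rpow hη.1 (by linarith : 0 ≤ a - 1)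
      exact div_le_div₀ (by linarith) this (hpos η hη) hη.2
    have : 0 < p * (a * (a - 1)) := mul_pos hp (mul_pos ha0 (by linarith))
    nlinarith
  · have hc1 : ContinuousOn (fun η => Real.exp (-(q * η ^ a))) (Icc 1 4) :=
      (continuousOn_const.mul (hcr a)).neg.rexp
    refine ContinuousOn.add (ContinuousOn.mul (by fun_prop) hc1) (ContinuousOn.mul (by fun_prop)
      (hc1.mul ((continuousOn_const.mul (continuousOn_const.mul (hcr _))).neg)))
  · intro η hη
    rw [abs_mul, abs_of_pos (Real.exp_pos _), hK]
    calc _ ≤ 6 * Real.exp (-(q / 2)) := mul_le_mul (abs_cutoff_le hη)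
            ((hexp η hη).trans hexp2) (Real.exp_pos _).le (by norm_num)
      _ ≤ _ := by
        have : 0 ≤ 12 * a * 4 ^ a := by positivity
        have := Real.exp_pos (-(q / 2))
        nlinarith
  · intro η hη
    refine (abs_add_le _ _).trans ?_
    rw [abs_mul, abs_mul (((η - 1) * (4 - η)) ^ 2), abs_mul (Real.exp _), abs_neg,
      abs_of_pos (Real.exp_pos _), abs_of_nonneg (mul_nonneg hq (mul_nonneg ha0.le
        (Real.rpow_nonneg (hpos η hη).le _)))]
    have t1 : |2 * ((η - 1) * (4 - η)) * (5 - 2 * η)| * Real.exp (-(q * η ^ a))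
        ≤ 18 * Real.exp (-(q / 2)) :=
      mul_le_mul (abs_deriv_cutoff_le hη) ((hexp η hη).trans hexp2) (Real.exp_pos _).le (by norm_num)
    have t2 : |((η - 1) * (4 - η)) ^ 2| * (Real.exp (-(q * η ^ a)) * (q * (a * η ^ (a - 1))))
        ≤ 6 * (2 * Real.exp (-(q / 2)) * (a * 4 ^ a)) := by
      have hr := rpow_le_four_rpow ha0.le (by linarith : a - 1 ≤ a) hη
      have hr0 : 0 ≤ η ^ (a - 1) := Real.rpow_nonneg (hpos η hη).le _
      refine mul_le_mul (abs_cutoff_le hη) ?_ (by positivity) (by norm_num)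
      calc _ ≤ Real.exp (-q) * (q * (a * 4 ^ a)) := by
            gcongr
            exact le_mul_of_one_le_right hq (Real.one_le_rpow hη.1 ha0.le)
        _ = q * Real.exp (-q) * (a * 4 ^ a) := by ring
        _ ≤ _ := by gcongr
    rw [hK]
    linarith

theorem norm_osc_le_of_ne_zero {a p q : ℝ} (ha : 1 < a) (hq : 0 ≤ q) (hp : p ≠ 0) (y : ℝ) :
    ‖osc a p q y‖ ≤ (18 + 12 * a * 4 ^ a) * (3 / 2 + 2 * Real.pi) / √(a * (a - 1) / 4)
      * ((√|p|)⁻¹ * Real.exp (-(q / 2))) := by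
  rcases lt_or_gt_of_ne hp with h | h
  · have := norm_osc_le_of_pos ha hq (neg_pos.2 h) (-y)
    rw [← conj_osc, RCLike.norm_conj] at this
    rwa [abs_of_neg h]
  · have := norm_osc_le_of_pos ha hq h y
    rwa [abs_of_pos h]

/-- Here the damping stays in the complex phase. The derivative of the phase has imaginary part at
least `|y|/2` in modulus, since `p` is too small to cancel `y`, and real part at least `q` in
modulus. It is therefore comparable with `|y| + q`, which also controls the higher derivatives,
uniformly in `q`. -/
theorem norm_osc_le_div_sq {a p q y : ℝ} (ha : 1 < a) (hq : 0 ≤ q) (hy : y ≠ 0)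
    (hpy : 2 * a * 4 ^ a * |p| ≤ |y|) :
    ‖osc a p q y‖ ≤ 24 * (27 + a * a * (a + 2) * 4 ^ a) ^ 7 / y ^ 2 := by
  have ha0 : 0 < a := by linarith
  have hpos : ∀ η ∈ Icc (1 : ℝ) 4, 0 < η := fun η hη => by linarith [hη.1]
  have h4a : (1 : ℝ) ≤ 4 ^ a := Real.one_le_rpow (by norm_num) ha0.le
  have hy0 : 0 < |y| := abs_pos.2 hy
  -- 27 bounds the cutoff and its two derivatives; `a · a · (a + 2)` dominates both `a(a-1)` and
  -- `|a(a-1)(a-2)|`.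
  set c : ℝ := 27 + a * a * (a + 2) * 4 ^ a with hc
  set R : ℝ := |y| + q with hR
  have hR0 : 0 < R := by positivity
  have hpR : |p| + q ≤ R := by
    have h1 : 1 ≤ 2 * a * 4 ^ a := by nlinarith
    have : |p| ≤ 2 * a * 4 ^ a * |p| := le_mul_of_one_le_left (abs_nonneg _) h1
    rw [hR]; linarith
  have hw : ‖Complex.I * p - q‖ ≤ |p| + q := by
    refine (norm_sub_le _ _).trans ?_
    simp [abs_of_nonneg hq]
  have hcr : ∀ b : ℝ, ContinuousOn (fun η : ℝ => ((η ^ b : ℝ) : ℂ)) (Icc 1 4) := fun b =>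
    Complex.continuous_ofReal.comp_continuousOn
      (continuousOn_id.rpow_const fun η hη => Or.inl (hpos η hη).ne')
  have hdr : ∀ b : ℝ, ∀ η ∈ Icc (1 : ℝ) 4,
      HasDerivAt (fun η : ℝ => ((η ^ b : ℝ) : ℂ)) (b * ((η ^ (b - 1) : ℝ) : ℂ)) η := by
    intro b η hη
    exact ((Real.hasDerivAt_rpow_const (p := b) (Or.inl (hpos η hη).ne')).ofReal_comp).congr_deriv
      (by push_cast; ring)
  have hb : ∀ (b : ℝ), b ≤ a → ∀ η ∈ Icc (1 : ℝ) 4, ‖((η ^ b : ℝ) : ℂ)‖ ≤ 4 ^ a := by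
    intro b hb η hη
    rw [Complex.norm_real, Real.norm_of_nonneg (Real.rpow_nonneg (hpos η hη).le _)]
    exact rpow_le_four_rpow ha0.le hb hη
  have key := norm_integral_mul_exp_le_of_deriv_ge (α := 1) (β := 4) (R := R) (c := c)
    (Λ := fun η => (Complex.I * p - q) * ((η ^ a : ℝ) : ℂ) + Complex.I * y * η)
    (Λ₁ := fun η => (Complex.I * p - q) * (a * ((η ^ (a - 1) : ℝ) : ℂ)) + Complex.I * y)
    (Λ₂ := fun η => (Complex.I * p - q) * (a * (((a - 1 : ℝ) : ℂ) * ((η ^ (a - 1 - 1) : ℝ) : ℂ))))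
    (Λ₃ := fun η => (Complex.I * p - q) * (a * (((a - 1 : ℝ) : ℂ) *
      (((a - 1 - 1 : ℝ) : ℂ) * ((η ^ (a - 1 - 1 - 1) : ℝ) : ℂ)))))
    (by norm_num) hR0 (by rw [hc]; nlinarith [show 0 ≤ a * a * (a + 2) * 4 ^ a by positivity])
    (fun η hη => (((hdr a η hη).const_mul _).fun_add
      (((hasDerivAt_id' η).ofReal_comp).const_mul (Complex.I * y))).congr_deriv (by simp))
    (fun η hη => (((hdr (a - 1) η hη).const_mul _).const_mul _).add_const _)
    (fun η hη => ((((hdr (a - 1 - 1) η hη).const_mul _).const_mul _).const_mul _))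
    (continuousOn_const.mul (continuousOn_const.mul (continuousOn_const.mul
      (continuousOn_const.mul (hcr _)))))
    (fun η _ => hasDerivAt_cutoff η) (fun η _ => hasDerivAt_deriv_cutoff η) (by fun_prop)
    ?_ ?_ ?_ ?_ ?_ ?_ ?_ (by norm_num) (by norm_num) (by norm_num) (by norm_num)
  · refine key.trans ?_
    have h1 : y ^ 2 ≤ R ^ 2 := by
      rw [← sq_abs y]
      exact pow_le_pow_left₀ (abs_nonneg _) (by rw [hR]; linarith) 2
    have h2 : 0 < y ^ 2 := by positivity
    have h3 : 0 ≤ 24 * c ^ 7 := by positivity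
    calc _ = 24 * c ^ 7 / R ^ 2 := by ring
      _ ≤ _ := div_le_div_of_nonneg_left h3 h2 h1
  · intro η hη
    have := Real.rpow_nonneg (hpos η hη).le a
    simp
    positivity
  · intro η hη
    set w : ℂ := (Complex.I * p - q) * (a * ((η ^ (a - 1) : ℝ) : ℂ)) + Complex.I * y with hw
    have hr1 := Real.one_le_rpow hη.1 (by linarith : 0 ≤ a - 1)
    have hr2 := rpow_le_four_rpow ha0.le (by linarith : a - 1 ≤ a) hη
    have ere : w.re = -(q * (a * η ^ (a - 1))) := by simp [hw]
    have eim : w.im = p * (a * η ^ (a - 1)) + y := by simp [hw]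
    have n1 : q ≤ ‖w‖ := by
      refine le_trans ?_ (Complex.abs_re_le_norm w)
      rw [ere, abs_neg, abs_of_nonneg (by positivity)]
      have : 1 ≤ a * η ^ (a - 1) := by nlinarith
      exact le_mul_of_one_le_right hq this
    have n2 : |y| / 2 ≤ ‖w‖ := by
      refine le_trans ?_ (Complex.abs_im_le_norm w)
      rw [eim]
      have h1 : |p * (a * η ^ (a - 1))| ≤ |y| / 2 := by
        rw [abs_mul, abs_of_nonneg (by positivity : 0 ≤ a * η ^ (a - 1))]
        have : |p| * (a * η ^ (a - 1)) ≤ |p| * (a * 4 ^ a) := by gcongr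
        linarith
      have h2 := abs_sub_abs_le_abs_sub y (-(p * (a * η ^ (a - 1))))
      rw [abs_neg, sub_neg_eq_add, add_comm y] at h2
      linarith
    have n3 : R ≤ 3 * ‖w‖ := by rw [hR]; linarith
    refine n3.trans (mul_le_mul_of_nonneg_right ?_ (norm_nonneg _))
    have : 0 ≤ a * a * (a + 2) * 4 ^ a := by positivity
    rw [hc]; linarith
  · intro η hη
    rw [norm_mul, norm_mul, norm_mul, Complex.norm_real, Complex.norm_real,
      Real.norm_of_nonneg ha0.le, Real.norm_of_nonneg (by linarith : 0 ≤ a - 1)]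
    calc _ ≤ R * (a * (a * 4 ^ a)) := by
          gcongr
          · exact hw.trans hpR
          · linarith
          · exact hb _ (by linarith) η hη
      _ ≤ R * c := by
          gcongr
          rw [hc]
          have : 0 ≤ a * a * 4 ^ a := by positivity
          nlinarith
      _ = _ := mul_comm _ _
  · intro η hη
    rw [norm_mul, norm_mul, norm_mul, norm_mul, Complex.norm_real, Complex.norm_real,
      Complex.norm_real,
      Real.norm_of_nonneg ha0.le, Real.norm_of_nonneg (by linarith : 0 ≤ a - 1), Real.norm_eq_abs]
    calc _ ≤ R * (a * (a * ((a + 2) * 4 ^ a))) := by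
          gcongr
          · exact hw.trans hpR
          · linarith
          · rw [abs_le]; constructor <;> linarith
          · exact hb _ (by linarith) η hη
      _ ≤ R * c := by
          gcongr
          rw [hc]
          linarith
      _ = _ := mul_comm _ _
  · exact fun η hη => (abs_cutoff_le hη).trans
      (by have : 0 ≤ a * a * (a + 2) * 4 ^ a := by positivity
          rw [hc]; linarith)
  · exact fun η hη => (abs_deriv_cutoff_le hη).trans
      (by have : 0 ≤ a * a * (a + 2) * 4 ^ a := by positivity
          rw [hc]; linarith)
  · exact fun η hη => (abs_deriv_deriv_cutoff_le hη).trans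
      (by have : 0 ≤ a * a * (a + 2) * 4 ^ a := by positivity
          rw [hc]; linarith)

/-! ### An integrable envelope, uniform in the times. -/

/-- The envelope of the normalised kernels. -/
noncomputable def envelope (B y : ℝ) : ℝ := (√|y|)⁻¹ * (1 + |y| / B)⁻¹ + (1 + y ^ 2)⁻¹

/-- This trades exponential decay in `q` for decay in `|p|/B ≤ q^r`. It is the inequality `v ≤ e^v`
at `v = q/(2r)`, raised to the power `r`. -/
theorem one_add_rpow_le_exp {r q : ℝ} (hr : 0 < r) (hq : 0 ≤ q) :
    1 + q ^ r ≤ (1 + (2 * r) ^ r) * Real.exp (q / 2) := by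
  have h1 : q / (2 * r) ≤ Real.exp (q / (2 * r)) := by
    linarith [Real.add_one_le_exp (q / (2 * r))]
  have h2 := Real.rpow_le_rpow (by positivity) h1 hr.le
  rw [Real.div_rpow hq (by positivity), ← Real.exp_mul, div_le_iff₀ (by positivity)] at h2
  have h3 : q / (2 * r) * r = q / 2 := by field_simp
  rw [h3] at h2
  have h4 : 1 ≤ Real.exp (q / 2) := Real.one_le_exp (by positivity)
  linarith

/-- The uniform bound for the normalised kernels. -/
theorem exists_norm_osc_le_envelope {a r : ℝ} (ha : 1 < a) (hr : 0 < r) :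
    ∃ C, 0 < C ∧ ∀ B p q y : ℝ, 0 < B → 0 ≤ q → |p| ≤ q ^ r * B →
      ‖osc a p q y‖ ≤ C * envelope B y := by
  have ha0 : 0 < a := by linarith
  have h4a : (1 : ℝ) ≤ 4 ^ a := Real.one_le_rpow (by norm_num) ha0.le
  set D : ℝ := 2 * a * 4 ^ a with hD
  have hD1 : 1 ≤ D := by rw [hD]; nlinarith
  set C₁ : ℝ := (18 + 12 * a * 4 ^ a) * (3 / 2 + 2 * Real.pi) / √(a * (a - 1) / 4) with hC₁
  have hC₁0 : 0 ≤ C₁ := by have := Real.pi_pos; positivity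
  set C₂ : ℝ := 24 * (27 + a * a * (a + 2) * 4 ^ a) ^ 7 with hC₂
  have hC₂0 : 0 ≤ C₂ := by positivity
  set C₃ : ℝ := C₁ * (D * ((1 + (2 * r) ^ r) * D)) with hC₃
  have hC₃0 : 0 ≤ C₃ := by positivity
  refine ⟨18 + C₂ + C₃, by positivity, fun B p q y hB hq hp => ?_⟩
  unfold envelope
  have hi1 : 0 ≤ (√|y|)⁻¹ * (1 + |y| / B)⁻¹ := by positivity
  have hi2 : 0 ≤ (1 + y ^ 2)⁻¹ := by positivity
  rcases eq_or_ne y 0 with rfl | hy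
  · have := norm_osc_le (a := a) (p := p) (y := 0) hq
    simp
    linarith
  have hy0 : 0 < |y| := abs_pos.2 hy
  rcases le_or_gt (D * |p|) |y| with h | h
  · have e1 := norm_osc_le (a := a) (p := p) (y := y) hq
    have e2 := norm_osc_le_div_sq ha hq hy h
    rw [← hC₂, le_div_iff₀ (by positivity)] at e2
    have e3 : ‖osc a p q y‖ ≤ (18 + C₂) * (1 + y ^ 2)⁻¹ := by
      rw [← div_eq_mul_inv, le_div_iff₀ (by positivity)]
      linarith
    refine e3.trans ?_
    calc (18 + C₂) * (1 + y ^ 2)⁻¹ ≤ (18 + C₂ + C₃) * (1 + y ^ 2)⁻¹ :=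
          mul_le_mul_of_nonneg_right (by linarith) hi2
      _ ≤ _ := by gcongr; linarith
  · have hp0 : p ≠ 0 := by
      rintro rfl
      simp at h
      exact absurd h (not_lt.2 (abs_nonneg y))
    have hpp : 0 < |p| := abs_pos.2 hp0
    have e1 := norm_osc_le_of_ne_zero ha hq hp0 y
    rw [← hC₁] at e1
    have s1 : (√|p|)⁻¹ ≤ D * (√|y|)⁻¹ := by
      rw [← div_eq_mul_inv, le_div_iff₀ (Real.sqrt_pos.2 hy0), inv_mul_le_iff₀ (Real.sqrt_pos.2 hpp)]
      have : √|y| ≤ √(D ^ 2 * |p|) := Real.sqrt_le_sqrt (by nlinarith)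
      rw [Real.sqrt_mul (by positivity), Real.sqrt_sq (by positivity)] at this
      linarith
    have s2 : Real.exp (-(q / 2)) ≤ (1 + (2 * r) ^ r) * D * (1 + |y| / B)⁻¹ := by
      rw [← div_eq_mul_inv, le_div_iff₀ (by positivity), Real.exp_neg,
        inv_mul_le_iff₀ (Real.exp_pos _)]
      have h1 := one_add_rpow_le_exp hr hq
      have h2 : |p| / B ≤ q ^ r := by rwa [div_le_iff₀ hB]
      have h3 : 1 + |y| / B ≤ D * (1 + |p| / B) := by
        have : |y| / B ≤ D * |p| / B := by gcongr
        rw [mul_add, ← mul_div_assoc]; linarith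
      calc 1 + |y| / B ≤ D * (1 + |p| / B) := h3
        _ ≤ D * ((1 + (2 * r) ^ r) * Real.exp (q / 2)) := by gcongr; linarith
        _ = _ := by ring
    calc _ ≤ C₁ * ((√|p|)⁻¹ * Real.exp (-(q / 2))) := e1
      _ ≤ C₁ * ((D * (√|y|)⁻¹) * ((1 + (2 * r) ^ r) * D * (1 + |y| / B)⁻¹)) := by gcongr
      _ = C₃ * ((√|y|)⁻¹ * (1 + |y| / B)⁻¹) := by rw [hC₃]; ring
      _ ≤ (18 + C₂ + C₃) * ((√|y|)⁻¹ * (1 + |y| / B)⁻¹) := by gcongr; linarith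
      _ ≤ _ := by gcongr; linarith

theorem integrable_inv_sqrt_mul_inv_one_add :
    Integrable fun u : ℝ => (√|u|)⁻¹ * (1 + |u|)⁻¹ := by
  have hmeas : Measurable fun u : ℝ => (√|u|)⁻¹ * (1 + |u|)⁻¹ := by fun_prop
  have h1 : IntegrableOn (fun u : ℝ => (√|u|)⁻¹ * (1 + |u|)⁻¹) (Ioc 0 1) := by
    have h := (intervalIntegral.intervalIntegrable_rpow' (a := 0) (b := 1)
      (by norm_num : (-1 : ℝ) < -(1 / 2))).1
    refine h.mono' hmeas.aestronglyMeasurable ?_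
    refine (ae_restrict_iff' measurableSet_Ioc).2 (Filter.Eventually.of_forall fun u hu => ?_)
    rw [Real.norm_of_nonneg (by positivity), abs_of_pos hu.1, Real.sqrt_eq_rpow, ←
      Real.rpow_neg hu.1.le]
    refine mul_le_of_le_one_right (Real.rpow_nonneg hu.1.le _) (inv_le_one_of_one_le₀ ?_)
    linarith [hu.1]
  have h2 : IntegrableOn (fun u : ℝ => (√|u|)⁻¹ * (1 + |u|)⁻¹) (Ioi 1) := by
    have h := integrableOn_Ioi_rpow_of_lt (by norm_num : (-(3 / 2) : ℝ) < -1) one_pos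
    refine h.mono' hmeas.aestronglyMeasurable ?_
    refine (ae_restrict_iff' measurableSet_Ioi).2 (Filter.Eventually.of_forall fun u hu => ?_)
    have hu0 : (0 : ℝ) < u := lt_trans one_pos hu
    rw [Real.norm_of_nonneg (by positivity), abs_of_pos hu0, Real.sqrt_eq_rpow, ←
      Real.rpow_neg hu0.le]
    have : u ^ (-(3 / 2) : ℝ) = u ^ (-(1 / 2) : ℝ) * u⁻¹ := by
      rw [← Real.rpow_neg_one u, ← Real.rpow_add hu0]; norm_num
    rw [this]
    gcongr
    linarith
  have h3 : IntegrableOn (fun u : ℝ => (√|u|)⁻¹ * (1 + |u|)⁻¹) (Ioi 0) := by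
    rw [← Ioc_union_Ioi_eq_Ioi zero_le_one]; exact h1.union h2
  have h4 : IntegrableOn (fun u : ℝ => (√|u|)⁻¹ * (1 + |u|)⁻¹) (Iio 0) := by
    have h : IntegrableOn (fun u : ℝ => (√|u|)⁻¹ * (1 + |u|)⁻¹) (Ioi (-0)) := by rwa [neg_zero]
    refine (IntegrableOn.comp_neg_Iio h).congr_fun (fun u _ => ?_) measurableSet_Iio
    simp only [abs_neg]
  rw [← integrableOn_univ, ← Iic_union_Ioi (a := (0 : ℝ))]
  exact ((integrableOn_Iic_iff_integrableOn_Iio).2 h4).union h3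

theorem envelope_eq {B : ℝ} (hB : 0 < B) : envelope B = fun y =>
    (√B)⁻¹ * ((√|y / B|)⁻¹ * (1 + |y / B|)⁻¹) + (1 + y ^ 2)⁻¹ := by
  funext y
  unfold envelope
  rw [abs_div, abs_of_pos hB, Real.sqrt_div (abs_nonneg y), inv_div]
  have : √B ≠ 0 := (Real.sqrt_pos.2 hB).ne'
  congr 1
  rw [← mul_assoc]
  congr 1
  field_simp

theorem integrable_envelope {B : ℝ} (hB : 0 < B) : Integrable (envelope B) := by
  rw [envelope_eq hB]
  exact ((integrable_inv_sqrt_mul_inv_one_add.comp_div hB.ne').const_mul _).add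
    integrable_inv_one_add_sq

/-- Scaling by `B` gives the first term of the envelope the integral `A √B`; the second contributes
`π`. As this bounds `T T*`, the loss for `T` itself is a fourth root of `B`, the source of the
factor 1/4 in the exponent. -/
theorem exists_integral_envelope_le :
    ∃ C, 0 < C ∧ ∀ B : ℝ, 0 < B → ∫ y, envelope B y ≤ C * √(max 1 B) := by
  set A : ℝ := ∫ u : ℝ, (√|u|)⁻¹ * (1 + |u|)⁻¹ with hA
  have hA0 : 0 ≤ A := integral_nonneg fun u => by positivity
  have hpi := Real.pi_pos
  refine ⟨A + Real.pi, by positivity, fun B hB => ?_⟩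
  rw [envelope_eq hB, integral_add
    ((integrable_inv_sqrt_mul_inv_one_add.comp_div hB.ne').const_mul _) integrable_inv_one_add_sq,
    integral_const_mul, Measure.integral_comp_div (fun u => (√|u|)⁻¹ * (1 + |u|)⁻¹) B,
    integral_univ_inv_one_add_sq, ← hA, abs_of_pos hB, smul_eq_mul]
  have h1 : (√B)⁻¹ * (B * A) = A * √B := by
    have h := Real.mul_self_sqrt hB.le
    have h0 : √B ≠ 0 := (Real.sqrt_pos.2 hB).ne'
    field_simp
    rw [sq, h]
  rw [h1, add_mul]
  have h2 : √B ≤ √(max 1 B) := Real.sqrt_le_sqrt (le_max_right _ _)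
  have h3 : 1 ≤ √(max 1 B) := Real.one_le_sqrt.2 (le_max_left _ _)
  exact add_le_add (by gcongr) (le_mul_of_one_le_right hpi.le h3)

/-! ### The evolution and the linearised maximal function. -/

/-- The Fourier multiplier of the evolution at the complex time `t + i t ^ γ`. -/
noncomputable def symb (a γ t ξ : ℝ) : ℂ :=
  Complex.exp ((Complex.I * t - ((t ^ γ : ℝ) : ℂ)) * ((|ξ| ^ a : ℝ) : ℂ))

/-- The evolution applied to a function given on the frequency side. -/
noncomputable def evol (a γ : ℝ) (g : ℝ → ℂ) (t x : ℝ) : ℂ :=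
  ∫ ξ : ℝ, g ξ * (symb a γ t ξ * Complex.exp (Complex.I * x * ξ))

theorem norm_symb_le {a γ t : ℝ} (ht : 0 < t) (ξ : ℝ) : ‖symb a γ t ξ‖ ≤ 1 := by
  rw [symb, Complex.norm_exp, Real.exp_le_one_iff]
  simp
  have := Real.rpow_nonneg ht.le γ
  have := Real.rpow_nonneg (abs_nonneg ξ) a
  positivity

theorem norm_exp_I_mul_mul (x ξ : ℝ) : ‖Complex.exp (Complex.I * x * ξ)‖ = 1 := by
  rw [Complex.norm_exp]; simp

theorem measurable_symb (a γ : ℝ) : Measurable fun z : ℝ × ℝ => symb a γ z.1 z.2 := by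
  unfold symb; fun_prop

theorem P_eq_evol (a γ t : ℝ) (f : 𝓢(ℝ, ℂ)) (x : ℝ) : P a γ t f x = evol a γ (hat f) t x := by
  unfold P evol symb
  congr 1
  funext ξ
  rw [mul_assoc, mul_assoc, ← mul_assoc (Complex.exp _), Complex.ofReal_exp, ← Complex.exp_add]
  congr 3
  push_cast
  ring_nf

theorem continuous_evol_left {a γ : ℝ} {g : ℝ → ℂ} (hg : Integrable g) (x : ℝ) :
    Continuous fun t : Ioo (0 : ℝ) 1 => evol a γ g t x := by
  unfold evol
  refine continuous_of_dominated (bound := fun ξ => ‖g ξ‖) (fun t => ?_)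
    (fun t => Filter.Eventually.of_forall fun ξ => ?_) hg.norm
    (Filter.Eventually.of_forall fun ξ => ?_)
  · have h1 : Measurable fun ξ => symb a γ t ξ :=
      (measurable_symb a γ).comp (measurable_const.prodMk measurable_id)
    exact hg.1.mul (h1.mul (by fun_prop)).aestronglyMeasurable
  · rw [norm_mul, norm_mul, norm_exp_I_mul_mul, mul_one]
    exact mul_le_of_le_one_right (norm_nonneg _) (norm_symb_le t.2.1 ξ)
  · have h1 : Continuous fun t : Ioo (0 : ℝ) 1 => ((t : ℝ) ^ γ : ℝ) :=
      continuous_subtype_val.rpow_const fun t => Or.inl t.2.1.ne'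
    unfold symb
    fun_prop

theorem continuous_evol_right {a γ t : ℝ} (ht : 0 < t) {g : ℝ → ℂ} (hg : Integrable g) :
    Continuous fun x => evol a γ g t x := by
  unfold evol
  refine continuous_of_dominated (bound := fun ξ => ‖g ξ‖) (fun x => ?_)
    (fun x => Filter.Eventually.of_forall fun ξ => ?_) hg.norm
    (Filter.Eventually.of_forall fun ξ => ?_)
  · have h1 : Measurable fun ξ => symb a γ t ξ :=
      (measurable_symb a γ).comp (measurable_const.prodMk measurable_id)
    exact hg.1.mul (h1.mul (by fun_prop)).aestronglyMeasurable
  · rw [norm_mul, norm_mul, norm_exp_I_mul_mul, mul_one]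
    exact mul_le_of_le_one_right (norm_nonneg _) (norm_symb_le ht ξ)
  · fun_prop

theorem iSup_sq_of_monotone {u : ℕ → ℝ≥0∞} (hu : Monotone u) : (⨆ n, u n) ^ 2 = ⨆ n, u n ^ 2 :=
  tendsto_nhds_unique (ENNReal.Tendsto.pow (tendsto_atTop_iSup hu))
    (tendsto_atTop_iSup fun _ _ hmn => pow_le_pow_left' (hu hmn) 2)

/-- A maximal estimate follows from the estimates for all measurable choices of the time. -/
theorem lintegral_iSup_sq_le_of_linearized {F : ℝ → ℝ → ℂ} {A : ℝ≥0∞}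
    (hc : ∀ x, Continuous fun t : Ioo (0 : ℝ) 1 => F t x)
    (hm : ∀ t ∈ Ioo (0 : ℝ) 1, Measurable (F t))
    (hA : ∀ τ : ℝ → ℝ, Measurable τ → (∀ x, τ x ∈ Ioo (0 : ℝ) 1) →
      ∫⁻ x, ‖F (τ x) x‖ₑ ^ 2 ≤ A) :
    ∫⁻ x, (⨆ t ∈ Ioo (0 : ℝ) 1, ‖F t x‖ₑ) ^ 2 ≤ A := by
  have : Nonempty (Ioo (0 : ℝ) 1) := ⟨⟨1 / 2, by norm_num, by norm_num⟩⟩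
  set d : ℕ → Ioo (0 : ℝ) 1 := TopologicalSpace.denseSeq (Ioo (0 : ℝ) 1) with hd
  -- The maximum over finitely many points of a dense sequence is attained by a measurable time.
  -- Measurability of `‖F (τ x) x‖ₑ` is carried through the induction, since `F` is not assumed
  -- jointly measurable. Continuity in `t` and monotone convergence then recover the full supremum.
  have choice : ∀ n : ℕ, ∃ τ : ℝ → ℝ, Measurable τ ∧ (∀ x, τ x ∈ Ioo (0 : ℝ) 1) ∧
      (Measurable fun x => ‖F (τ x) x‖ₑ) ∧ ∀ i ≤ n, ∀ x, ‖F (d i) x‖ₑ ≤ ‖F (τ x) x‖ₑ := by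
    intro n
    induction n with
    | zero =>
      refine ⟨fun _ => d 0, measurable_const, fun _ => (d 0).2, (hm _ (d 0).2).enorm, ?_⟩
      intro i hi x
      obtain rfl : i = 0 := by omega
      exact le_rfl
    | succ n ih =>
      obtain ⟨τ, h1, h2, h3, h4⟩ := ih
      have hS : MeasurableSet {x | ‖F (τ x) x‖ₑ < ‖F (d (n + 1)) x‖ₑ} :=
        measurableSet_lt h3 (hm _ (d (n + 1)).2).enorm
      classical
      have e : ∀ x, ‖F (if ‖F (τ x) x‖ₑ < ‖F (d (n + 1)) x‖ₑ then (d (n + 1) : ℝ) else τ x) x‖ₑ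
          = if ‖F (τ x) x‖ₑ < ‖F (d (n + 1)) x‖ₑ then ‖F (d (n + 1)) x‖ₑ else ‖F (τ x) x‖ₑ := by
        intro x; split_ifs <;> rfl
      refine ⟨fun x => if ‖F (τ x) x‖ₑ < ‖F (d (n + 1)) x‖ₑ then d (n + 1) else τ x,
        Measurable.ite hS measurable_const h1, fun x => ?_, ?_, ?_⟩
      · dsimp only
        split_ifs
        · exact (d (n + 1)).2
        · exact h2 x
      · simp_rw [e]
        exact Measurable.ite hS (hm _ (d (n + 1)).2).enorm h3
      · intro i hi x
        dsimp only
        rw [e]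
        rcases Nat.lt_or_ge n i with h | h
        · obtain rfl : i = n + 1 := by omega
          split_ifs with h'
          · exact le_rfl
          · exact not_lt.1 h'
        · split_ifs with h'
          · exact (h4 i h x).trans h'.le
          · exact h4 i h x
  set S : ℕ → ℝ → ℝ≥0∞ := fun n x => (⨆ i ∈ Iic n, ‖F (d i) x‖ₑ) ^ 2 with hS
  have hSm : ∀ n, Measurable (S n) := fun n =>
    (Measurable.biSup _ (to_countable _) fun i _ => (hm _ (d i).2).enorm).pow_const 2
  have hmono : Monotone S := fun m n hmn x =>
    pow_le_pow_left' (biSup_mono fun i (hi : i ≤ m) => hi.trans hmn) 2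
  have hSA : ∀ n, ∫⁻ x, S n x ≤ A := by
    intro n
    obtain ⟨τ, h1, h2, -, h4⟩ := choice n
    refine le_trans (lintegral_mono fun x => ?_) (hA τ h1 h2)
    exact pow_le_pow_left' (iSup₂_le fun i hi => h4 i hi x) 2
  have hpt : ∀ x, (⨆ t ∈ Ioo (0 : ℝ) 1, ‖F t x‖ₑ) ^ 2 ≤ ⨆ n, S n x := by
    intro x
    have hle : ∀ t : Ioo (0 : ℝ) 1, ‖F t x‖ₑ ≤ ⨆ n, ‖F (d n) x‖ₑ := by
      have hcl : IsClosed {t : Ioo (0 : ℝ) 1 | ‖F t x‖ₑ ≤ ⨆ n, ‖F (d n) x‖ₑ} :=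
        isClosed_le (hc x).enorm continuous_const
      intro t
      have : t ∈ closure (range d) := TopologicalSpace.denseRange_denseSeq (Ioo (0 : ℝ) 1) t
      refine hcl.closure_subset_iff.2 ?_ this
      rintro _ ⟨n, rfl⟩
      exact le_iSup (fun n => ‖F (d n) x‖ₑ) n
    calc _ ≤ (⨆ n, ‖F (d n) x‖ₑ) ^ 2 :=
          pow_le_pow_left' (iSup₂_le fun t ht => hle ⟨t, ht⟩) 2
      _ = ⨆ n, (⨆ i ∈ Iic n, ‖F (d i) x‖ₑ) ^ 2 := by
          have hm' : Monotone fun n => ⨆ i ∈ Iic n, ‖F (d i) x‖ₑ := fun m n hmn =>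
            biSup_mono fun i (hi : i ≤ m) => hi.trans hmn
          have e : ⨆ n, ‖F (d n) x‖ₑ = ⨆ n, ⨆ i ∈ Iic n, ‖F (d i) x‖ₑ :=
            le_antisymm
              (iSup_le fun n => le_iSup_of_le n (le_iSup₂_of_le n (mem_Iic.2 le_rfl) le_rfl))
              (iSup_le fun n => iSup₂_le fun i _ => le_iSup (fun n => ‖F (d n) x‖ₑ) i)
          rw [e, iSup_sq_of_monotone hm']
      _ = _ := rfl
  calc _ ≤ ∫⁻ x, ⨆ n, S n x := lintegral_mono hpt
    _ = ⨆ n, ∫⁻ x, S n x := lintegral_iSup hSm hmono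
    _ ≤ A := iSup_le hSA

/-! ### The maximal estimate at one frequency scale. -/

/-- The cutoff to a dyadic frequency interval. -/
noncomputable def cutoff (η : ℝ) : ℝ := (Icc (1 : ℝ) 4).indicator (fun η => (η - 1) * (4 - η)) η

theorem measurable_cutoff : Measurable cutoff :=
  Measurable.indicator (by fun_prop) measurableSet_Icc

theorem cutoff_nonneg (η : ℝ) : 0 ≤ cutoff η := by
  refine indicator_nonneg (fun η hη => mul_nonneg ?_ ?_) η <;> linarith [hη.1, hη.2]

theorem cutoff_le (η : ℝ) : cutoff η ≤ (Icc (1 : ℝ) 4).indicator (fun _ => 3) η := by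
  refine indicator_le_indicator ?_
  nlinarith [sq_nonneg (η - 5 / 2)]

/-- The lower bound allows division by the cutoff on the support of the data. -/
theorem one_le_cutoff {η : ℝ} (hη : η ∈ Ico (3 / 2 : ℝ) 3) : 1 ≤ cutoff η := by
  have h : η ∈ Icc (1 : ℝ) 4 := ⟨by linarith [hη.1], by linarith [hη.2]⟩
  rw [cutoff, indicator_of_mem h]
  nlinarith [hη.1, hη.2]

/-- Substituting `ξ = c η` scales `|ξ|^a` by `|c|^a`. Conjugation makes the times subtract and the
dampings add. Negative `c` serves the negative frequencies. -/
theorem integral_cutoff_eq_osc {a γ c : ℝ} (hc : c ≠ 0) (t t' x x' : ℝ) :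
    ∫ ξ : ℝ, ((cutoff (ξ / c) : ℂ) * (symb a γ t ξ * Complex.exp (Complex.I * x * ξ))) *
      conj ((cutoff (ξ / c) : ℂ) * (symb a γ t' ξ * Complex.exp (Complex.I * x' * ξ)))
    = |c| * osc a ((t - t') * |c| ^ a) ((t ^ γ + t' ^ γ) * |c| ^ a) ((x - x') * c) := by
  set G : ℝ → ℂ := fun η => (((cutoff η) ^ 2 : ℝ) : ℂ) * Complex.exp
    ((Complex.I * (((t - t') * |c| ^ a : ℝ) : ℂ) - (((t ^ γ + t' ^ γ) * |c| ^ a : ℝ) : ℂ))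
      * ((|η| ^ a : ℝ) : ℂ) + Complex.I * (((x - x') * c : ℝ) : ℂ) * η) with hG
  have h1 : ∀ ξ : ℝ, ((cutoff (ξ / c) : ℂ) * (symb a γ t ξ * Complex.exp (Complex.I * x * ξ))) *
      conj ((cutoff (ξ / c) : ℂ) * (symb a γ t' ξ * Complex.exp (Complex.I * x' * ξ)))
      = G (ξ / c) := by
    intro ξ
    have hξ : |ξ| ^ a = |c| ^ a * |ξ / c| ^ a := by
      rw [← Real.mul_rpow (abs_nonneg _) (abs_nonneg _), ← abs_mul, mul_div_cancel₀ _ hc]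
    have hcc : (c : ℂ) ≠ 0 := by exact_mod_cast hc
    unfold symb
    rw [map_mul, map_mul, Complex.conj_ofReal, ← Complex.exp_conj, ← Complex.exp_conj,
      ← Complex.exp_add, ← Complex.exp_add, mul_mul_mul_comm, ← Complex.exp_add, hG]
    simp only
    congr 1
    · push_cast; ring
    · congr 1
      rw [hξ]
      simp only [map_mul, map_sub, Complex.conj_I, Complex.conj_ofReal]
      push_cast
      field_simp
      ring
  simp_rw [h1]
  rw [Measure.integral_comp_div G c, Complex.real_smul]
  congr 1
  rw [osc, intervalIntegral.integral_of_le (by norm_num), ← integral_Icc_eq_integral_Ioc,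
    ← integral_indicator measurableSet_Icc]
  congr 1
  funext η
  by_cases hη : η ∈ Icc (1 : ℝ) 4
  · rw [indicator_of_mem hη, hG]
    simp only
    rw [cutoff, indicator_of_mem hη, abs_of_pos (by linarith [hη.1] : 0 < η)]
  · rw [indicator_of_notMem hη, hG]
    simp only
    rw [cutoff, indicator_of_notMem hη]
    simp

/-- For positive times, `|t - t'|` is at most the larger of them, hence at most `(t^γ +
t'^γ)^{1/γ}`. The power of `N` left over is `a - a/γ`: this is where the critical exponent enters.
-/
theorem abs_time_sub_mul_rpow_le {a γ t t' N : ℝ} (hγ : 0 < γ) (ht : 0 < t) (ht' : 0 < t')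
    (hN : 0 < N) : |(t - t') * N ^ a| ≤
      ((t ^ γ + t' ^ γ) * N ^ a) ^ (1 / γ) * N ^ (a * (1 - 1 / γ)) := by
  have hNa : 0 < N ^ a := Real.rpow_pos_of_pos hN _
  have h0 : 0 < t ^ γ := Real.rpow_pos_of_pos ht _
  have h0' : 0 < t' ^ γ := Real.rpow_pos_of_pos ht' _
  have key : ∀ s u : ℝ, 0 < s → 0 < u → s ≤ (s ^ γ + u ^ γ) ^ (1 / γ) := by
    intro s u hs hu
    calc s = (s ^ γ) ^ (1 / γ) := by
          rw [← Real.rpow_mul hs.le, mul_one_div_cancel hγ.ne', Real.rpow_one]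
      _ ≤ _ := Real.rpow_le_rpow (Real.rpow_nonneg hs.le _)
          (le_add_of_nonneg_right (Real.rpow_nonneg hu.le _)) (by positivity)
  have h1 : |t - t'| ≤ (t ^ γ + t' ^ γ) ^ (1 / γ) := by
    have k1 := key t t' ht ht'
    have k2 := key t' t ht' ht
    rw [add_comm] at k2
    rw [abs_le]; constructor <;> linarith
  rw [abs_mul, abs_of_pos hNa, Real.mul_rpow (by positivity) hNa.le, mul_assoc,
    ← Real.rpow_mul hN.le, ← Real.rpow_add hN,
    show a * (1 / γ) + a * (1 - 1 / γ) = a by ring]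
  gcongr

/-- The maximal estimate for functions with frequencies in `c * [3/2, 3)`. -/
theorem exists_lintegral_iSup_evol_le {a γ : ℝ} (ha : 1 < a) (hγ : 0 < γ) :
    ∃ C : ℝ, 0 < C ∧ ∀ c : ℝ, c ≠ 0 → ∀ g : ℝ → ℂ, Integrable g → MemLp g 2 volume →
      (∀ ξ, g ξ ≠ 0 → ξ / c ∈ Ico (3 / 2 : ℝ) 3) →
      ∫⁻ x, (⨆ t ∈ Ioo (0 : ℝ) 1, ‖evol a γ g t x‖ₑ) ^ 2 ≤
        ENNReal.ofReal (C * √(max 1 (|c| ^ (a * (1 - 1 / γ))))) * ∫⁻ ξ, ‖g ξ‖ₑ ^ 2 := by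
  obtain ⟨C₁, hC₁, h₁⟩ := exists_norm_osc_le_envelope ha (one_div_pos.2 hγ)
  obtain ⟨C₂, hC₂, h₂⟩ := exists_integral_envelope_le
  refine ⟨C₁ * C₂, by positivity, fun c hc g hg hg2 hsupp => ?_⟩
  have hc0 : 0 < |c| := abs_pos.2 hc
  set B : ℝ := |c| ^ (a * (1 - 1 / γ)) with hB
  have hB0 : 0 < B := Real.rpow_pos_of_pos hc0 _
  refine lintegral_iSup_sq_le_of_linearized (continuous_evol_left hg)
    (fun t ht => (continuous_evol_right ht.1 hg).measurable) fun τ hτ hτ' => ?_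
  -- The cutoff is moved from the data into the multiplier `m`; dividing by it does not increase
  -- `‖g‖`.
  set h : ℝ → ℂ := fun ξ => g ξ * (((cutoff (ξ / c))⁻¹ : ℝ) : ℂ) with hh
  have hcm : Measurable fun ξ => cutoff (ξ / c) := measurable_cutoff.comp (by fun_prop)
  have hhle : ∀ ξ, ‖h ξ‖ ≤ ‖g ξ‖ := by
    intro ξ
    by_cases hξ : g ξ = 0
    · simp [hh, hξ]
    · have := one_le_cutoff (hsupp ξ hξ)
      rw [hh]
      simp only
      rw [norm_mul, Complex.norm_real, Real.norm_of_nonneg (inv_nonneg.2 (cutoff_nonneg _))]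
      exact mul_le_of_le_one_right (norm_nonneg _) (inv_le_one_of_one_le₀ this)
  have hh2 : MemLp h 2 volume :=
    hg2.of_le (hg.1.mul (Complex.measurable_ofReal.comp hcm.inv).aestronglyMeasurable)
      (Filter.Eventually.of_forall hhle)
  set m : ℝ → ℝ → ℂ := fun x ξ =>
    (cutoff (ξ / c) : ℂ) * (symb a γ (τ x) ξ * Complex.exp (Complex.I * x * ξ)) with hm
  have hmm : Measurable (Function.uncurry m) := by
    have e1 : Measurable fun z : ℝ × ℝ => symb a γ (τ z.1) z.2 :=
      (measurable_symb a γ).comp ((hτ.comp measurable_fst).prodMk measurable_snd)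
    have e2 : Measurable fun z : ℝ × ℝ => ((cutoff (z.2 / c) : ℝ) : ℂ) :=
      Complex.measurable_ofReal.comp (hcm.comp measurable_snd)
    exact e2.mul (e1.mul (by fun_prop))
  set M : ℝ → ℝ := (Icc (-(4 * |c|)) (4 * |c|)).indicator fun _ => 3 with hM
  have hcM : ∀ ξ, cutoff (ξ / c) ≤ M ξ := by
    intro ξ
    refine (cutoff_le _).trans ?_
    by_cases hξ : ξ / c ∈ Icc (1 : ℝ) 4
    · rw [indicator_of_mem hξ, hM, indicator_of_mem]
      have : |ξ / c| ≤ 4 := abs_le.2 ⟨by linarith [hξ.1], hξ.2⟩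
      rw [abs_div, div_le_iff₀ hc0] at this
      exact abs_le.1 this
    · rw [indicator_of_notMem hξ]
      exact indicator_nonneg (fun _ _ => by norm_num) _
  have hmM : ∀ x ξ, ‖m x ξ‖ ≤ M ξ := by
    intro x ξ
    rw [hm]
    simp only
    rw [norm_mul, norm_mul, norm_exp_I_mul_mul, mul_one, Complex.norm_real,
      Real.norm_of_nonneg (cutoff_nonneg _)]
    exact (mul_le_of_le_one_right (cutoff_nonneg _) (norm_symb_le (hτ' x).1 ξ)).trans (hcM ξ)
  have hML : MemLp M 2 volume := memLp_indicator_const 2 measurableSet_Icc 3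
    (Or.inr (by simp))
  have hk : Integrable fun z => |c| * (C₁ * envelope B (z * c)) :=
    (((integrable_envelope hB0).const_mul C₁).comp_mul_right' hc).const_mul _
  have hkint : ∫ z, |c| * (C₁ * envelope B (z * c)) ≤ C₁ * C₂ * √(max 1 B) := by
    rw [integral_const_mul, Measure.integral_comp_mul_right (fun z => C₁ * envelope B z),
      integral_const_mul, smul_eq_mul, abs_inv, mul_inv_cancel_left₀ hc0.ne', mul_assoc]
    exact mul_le_mul_of_nonneg_left (h₂ B hB0) hC₁.le
  have hK : ∀ x x', ‖∫ ξ, m x ξ * conj (m x' ξ)‖ ≤ |c| * (C₁ * envelope B ((x - x') * c)) := by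
    intro x x'
    rw [hm]
    simp only
    rw [integral_cutoff_eq_osc hc, norm_mul, Complex.norm_real, Real.norm_eq_abs, abs_abs]
    refine mul_le_mul_of_nonneg_left (h₁ _ _ _ _ hB0 ?_
      (abs_time_sub_mul_rpow_le hγ (hτ' x).1 (hτ' x').1 hc0)) hc0.le
    have := Real.rpow_nonneg (hτ' x).1.le γ
    have := Real.rpow_nonneg (hτ' x').1.le γ
    positivity
  have key := lintegral_enorm_sq_le_of_kernel hmm hmM hML hh2 hk hK
    (by positivity : 0 < C₁ * C₂ * √(max 1 B)) hkint
  have e : ∀ x, evol a γ g (τ x) x = ∫ ξ, h ξ * m x ξ := by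
    intro x
    unfold evol
    congr 1
    funext ξ
    by_cases hξ : g ξ = 0
    · simp [hh, hξ]
    · have := one_le_cutoff (hsupp ξ hξ)
      have h0 : ((cutoff (ξ / c) : ℝ) : ℂ) ≠ 0 := by
        exact_mod_cast (by linarith : cutoff (ξ / c) ≠ 0)
      simp only [hh, hm]
      push_cast
      field_simp
  simp_rw [e]
  refine key.trans ?_
  gcongr with ξ
  exact enorm_le_iff_norm_le.2 (hhle ξ)

/-! ### Low frequencies. -/

theorem eLpNorm_two_eq {ε : Type*} [ENorm ε] (F : ℝ → ε) :
    eLpNorm F 2 volume = (∫⁻ x, ‖F x‖ₑ ^ 2) ^ (1 / 2 : ℝ) := by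
  rw [eLpNorm_eq_lintegral_rpow_enorm_toReal (by norm_num) (by norm_num)]
  simp

theorem eLpNorm_two_sq {ε : Type*} [ENorm ε] (F : ℝ → ε) :
    eLpNorm F 2 volume ^ 2 = ∫⁻ x, ‖F x‖ₑ ^ 2 := by
  rw [eLpNorm_two_eq, ← ENNReal.rpow_natCast, ← ENNReal.rpow_mul]
  norm_num

theorem le_of_sq_le_sq_ennreal {u v : ℝ≥0∞} (h : u ^ 2 ≤ v ^ 2) : u ≤ v :=
  (ENNReal.pow_le_pow_left_iff (by norm_num)).1 h

/-- Minkowski's inequality for series of nonnegative functions. -/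
theorem eLpNorm_two_tsum_le {f : ℕ → ℝ → ℝ≥0∞} (hf : ∀ n, Measurable (f n)) :
    eLpNorm (fun x => ∑' n, f n x) 2 volume ≤ ∑' n, eLpNorm (f n) 2 volume := by
  refine le_of_sq_le_sq_ennreal ?_
  rw [eLpNorm_two_sq]
  have hmono : ∀ x, Monotone fun n => ∑ i ∈ Finset.range n, f i x := fun x m n hmn =>
    Finset.sum_le_sum_of_subset (Finset.range_subset_range.2 hmn)
  have h1 : ∀ x, ‖∑' n, f n x‖ₑ ^ 2 = ⨆ n, (∑ i ∈ Finset.range n, f i x) ^ 2 := by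
    intro x
    rw [enorm_eq_self, ENNReal.tsum_eq_iSup_nat, iSup_sq_of_monotone (hmono x)]
  simp_rw [h1]
  rw [lintegral_iSup (fun n => (Finset.measurable_sum _ fun i _ => hf i).pow_const 2)
    fun m n hmn x => pow_le_pow_left' (hmono x hmn) 2]
  refine iSup_le fun n => ?_
  have h2 := eLpNorm_sum_le (μ := volume) (p := 2) (s := Finset.range n) (f := f)
    (fun i _ => (hf i).aestronglyMeasurable) (by norm_num)
  have h3 := eLpNorm_two_sq (∑ i ∈ Finset.range n, f i)
  simp only [enorm_eq_self, Finset.sum_apply] at h3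
  rw [← h3]
  exact pow_le_pow_left' (h2.trans (ENNReal.sum_le_tsum _)) 2

/-- The maximal function of the evolution on the frequency side. -/
noncomputable def maxEvol (a γ : ℝ) (g : ℝ → ℂ) (x : ℝ) : ℝ≥0∞ :=
  ⨆ t ∈ Ioo (0 : ℝ) 1, ‖evol a γ g t x‖ₑ

/-- The supremum is uncountable, but a supremum of functions continuous in `x` is lower
semicontinuous. -/
theorem measurable_maxEvol {a γ : ℝ} {g : ℝ → ℂ} (hg : Integrable g) :
    Measurable (maxEvol a γ g) := by
  refine LowerSemicontinuous.measurable ?_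
  refine lowerSemicontinuous_biSup fun t ht => ?_
  exact (continuous_evol_right ht.1 hg).enorm.lowerSemicontinuous

/-- A smooth Fourier multiplier norm bound for frequencies in a bounded interval. -/
theorem exists_eLpNorm_integral_exp_le :
    ∃ C : ℝ≥0, ∀ g : ℝ → ℂ, MemLp g 2 volume → (∀ ξ, g ξ ≠ 0 → |ξ| ≤ 3 / 2) →
      eLpNorm (fun x : ℝ => ∫ ξ : ℝ, g ξ * Complex.exp (Complex.I * x * ξ)) 2 volume
        ≤ C * eLpNorm g 2 volume := by
  set c₀ : ℝ := ‖((Real.pi : ℂ) / 1) ^ (1 / 2 : ℂ)‖ with hc₀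
  set k : ℝ → ℝ := fun z => c₀ * Real.exp (-(1 / 4) * z ^ 2) with hk
  have hkint : Integrable k := (integrable_exp_neg_mul_sq (by norm_num)).const_mul _
  have hk0 : 0 ≤ ∫ z, k z := integral_nonneg fun z => by positivity
  set κ : ℝ := (∫ z, k z) + 1 with hκ
  have hκ0 : 0 < κ := by positivity
  refine ⟨(√(κ * Real.exp (9 / 4))).toNNReal, fun g hg hsupp => ?_⟩
  -- A Gaussian weight is put into the multiplier and removed from `g`, at a cost of at most
  -- `e^{9/8}` since `|ξ| ≤ 3/2`. The `T T*` kernel becomes an explicit Gaussian.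
  set m : ℝ → ℝ → ℂ := fun x ξ =>
    ((Real.exp (-(ξ ^ 2 / 2)) : ℝ) : ℂ) * Complex.exp (Complex.I * x * ξ) with hm
  set h : ℝ → ℂ := fun ξ => g ξ * ((Real.exp (ξ ^ 2 / 2) : ℝ) : ℂ) with hh
  have hle : ∀ ξ, ‖h ξ‖ ≤ ‖Real.exp (9 / 8) * g ξ‖ := by
    intro ξ
    by_cases hξ : g ξ = 0
    · simp [hh, hξ]
    · rw [hh]
      simp only
      rw [norm_mul, norm_mul, mul_comm, Complex.norm_real, Complex.norm_real,
        Real.norm_of_nonneg (Real.exp_pos _).le, Real.norm_of_nonneg (Real.exp_pos _).le]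
      have := hsupp ξ hξ
      refine mul_le_mul_of_nonneg_right (Real.exp_le_exp.2 ?_) (norm_nonneg _)
      rw [← sq_abs]
      nlinarith [abs_nonneg ξ]
  have hh2 : MemLp h 2 volume := (hg.const_mul _).of_le (hg.1.mul (by fun_prop))
    (Filter.Eventually.of_forall hle)
  have hmM : ∀ x ξ, ‖m x ξ‖ ≤ Real.exp (-(ξ ^ 2 / 2)) := by
    intro x ξ
    rw [hm]
    simp only
    rw [norm_mul, norm_exp_I_mul_mul, mul_one, Complex.norm_real,
      Real.norm_of_nonneg (Real.exp_pos _).le]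
  have hM : MemLp (fun ξ : ℝ => Real.exp (-(ξ ^ 2 / 2))) 2 volume := by
    rw [memLp_two_iff_integrable_sq (by fun_prop)]
    refine (integrable_exp_neg_mul_sq one_pos).congr (Filter.Eventually.of_forall fun ξ => ?_)
    simp only
    rw [sq (Real.exp _), ← Real.exp_add]
    ring_nf
  have hK : ∀ x x', ‖∫ ξ, m x ξ * conj (m x' ξ)‖ ≤ k (x - x') := by
    intro x x'
    have e1 : ∀ ξ : ℝ, m x ξ * conj (m x' ξ) =
        Complex.exp (Complex.I * ((x - x' : ℝ) : ℂ) * ξ) * Complex.exp (-1 * ξ ^ 2) := by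
      intro ξ
      simp only [hm]
      rw [map_mul, Complex.conj_ofReal, ← Complex.exp_conj, Complex.ofReal_exp,
        ← Complex.exp_add, ← Complex.exp_add, ← Complex.exp_add,
        ← Complex.exp_add, map_mul, map_mul, Complex.conj_I, Complex.conj_ofReal,
        Complex.conj_ofReal]
      congr 1
      push_cast
      ring
    simp_rw [e1]
    rw [fourierIntegral_gaussian (by norm_num), norm_mul, ← hc₀, Complex.norm_exp]
    refine le_of_eq ?_
    rw [hk]
    simp only
    congr 2
    have : (-((x - x' : ℝ) : ℂ) ^ 2 / (4 * 1)) = ((-(1 / 4) * (x - x') ^ 2 : ℝ) : ℂ) := by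
      push_cast; ring
    rw [this, Complex.ofReal_re]
  have key := lintegral_enorm_sq_le_of_kernel (by simp only [hm]; fun_prop) hmM hM hh2 hkint hK hκ0
    (by rw [hκ]; linarith)
  have e : ∀ x : ℝ, (∫ ξ : ℝ, g ξ * Complex.exp (Complex.I * x * ξ)) = ∫ ξ, h ξ * m x ξ := by
    intro x
    congr 1
    funext ξ
    simp only [hh, hm]
    have : ((Real.exp (ξ ^ 2 / 2) : ℝ) : ℂ) * ((Real.exp (-(ξ ^ 2 / 2)) : ℝ) : ℂ) = 1 := by
      rw [← Complex.ofReal_mul, ← Real.exp_add]; simp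
    linear_combination (-(g ξ) * Complex.exp (Complex.I * x * ξ)) * this
  simp_rw [e]
  refine le_of_sq_le_sq_ennreal ?_
  rw [mul_pow, eLpNorm_two_sq]
  refine key.trans ?_
  rw [← eLpNorm_two_sq]
  have h1 : eLpNorm h 2 volume ≤ ENNReal.ofReal (Real.exp (9 / 8)) * eLpNorm g 2 volume := by
    refine (eLpNorm_mono (g := fun ξ => (Real.exp (9 / 8) : ℂ) * g ξ) hle).trans_eq ?_
    rw [show (fun ξ => (Real.exp (9 / 8) : ℂ) * g ξ) = (Real.exp (9 / 8) : ℂ) • g from rfl,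
      eLpNorm_const_smul, ← ofReal_norm, Complex.norm_real,
      Real.norm_of_nonneg (Real.exp_pos _).le]
  have h2 : ((√(κ * Real.exp (9 / 4))).toNNReal : ℝ≥0∞) ^ 2
      = ENNReal.ofReal κ * ENNReal.ofReal (Real.exp (9 / 8)) ^ 2 := by
    change ENNReal.ofReal _ ^ 2 = _
    rw [← ENNReal.ofReal_pow (Real.sqrt_nonneg _), Real.sq_sqrt (by positivity),
      ← ENNReal.ofReal_pow (Real.exp_pos _).le, ← ENNReal.ofReal_mul hκ0.le, ← Real.exp_nat_mul]
    norm_num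
  rw [h2, mul_assoc, ← mul_pow]
  gcongr

/-- The maximal estimate for low frequencies. -/
theorem exists_eLpNorm_maxEvol_low_le {a : ℝ} (ha : 1 < a) :
    ∃ C : ℝ≥0, ∀ γ : ℝ, 0 < γ → ∀ g : ℝ → ℂ, Integrable g → MemLp g 2 volume →
      (∀ ξ, g ξ ≠ 0 → |ξ| ≤ 3 / 2) →
      eLpNorm (maxEvol a γ g) 2 volume ≤ C * eLpNorm g 2 volume := by
  obtain ⟨C₀, h₀⟩ := exists_eLpNorm_integral_exp_le
  set D : ℝ := (3 / 2) ^ a with hD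
  have hD0 : 0 < D := by positivity
  refine ⟨C₀ * (Real.exp (2 * D)).toNNReal, fun γ hγ g hg hg2 hsupp => ?_⟩
  -- Expanding `e^{w |ξ|^a}` with `w = it - t^γ` separates `t` from `x`. As `‖w‖ ≤ 2`, the supremum
  -- over `t` costs only `2^n/n!` in the `n`-th term, whose function `F n` does not involve `t`.
  set gk : ℕ → ℝ → ℂ := fun n ξ => (((|ξ| ^ a) ^ n : ℝ) : ℂ) * g ξ with hgk
  have hgkle : ∀ n ξ, ‖gk n ξ‖ ≤ ‖((D ^ n : ℝ) : ℂ) * g ξ‖ := by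
    intro n ξ
    by_cases hξ : g ξ = 0
    · simp [hgk, hξ]
    · rw [hgk]
      simp only
      have h0 : 0 ≤ |ξ| ^ a := Real.rpow_nonneg (abs_nonneg _) _
      rw [norm_mul, norm_mul, Complex.norm_real, Complex.norm_real,
        Real.norm_of_nonneg (by positivity), Real.norm_of_nonneg (by positivity)]
      gcongr
      exact Real.rpow_le_rpow (abs_nonneg _) (hsupp ξ hξ) (by linarith)
  have hgkm : ∀ n, AEStronglyMeasurable (gk n) volume := fun n =>
    (Measurable.aestronglyMeasurable (by fun_prop)).mul hg.1
  have hgk1 : ∀ n, Integrable (gk n) := fun n =>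
    (hg.const_mul _).mono (hgkm n) (Filter.Eventually.of_forall (hgkle n))
  have hgk2 : ∀ n, MemLp (gk n) 2 volume := fun n =>
    (hg2.const_mul _).of_le (hgkm n) (Filter.Eventually.of_forall (hgkle n))
  have hgksupp : ∀ n ξ, gk n ξ ≠ 0 → |ξ| ≤ 3 / 2 := fun n ξ h =>
    hsupp ξ fun h' => h (by simp [hgk, h'])
  set F : ℕ → ℝ → ℂ := fun n x => ∫ ξ : ℝ, gk n ξ * Complex.exp (Complex.I * x * ξ) with hF
  have hFc : ∀ n, Continuous (F n) := by
    intro n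
    refine continuous_of_dominated (bound := fun ξ => ‖gk n ξ‖) (fun x => ?_)
      (fun x => Filter.Eventually.of_forall fun ξ => ?_) (hgk1 n).norm
      (Filter.Eventually.of_forall fun ξ => ?_)
    · exact (hgkm n).mul (by fun_prop)
    · rw [norm_mul, norm_exp_I_mul_mul, mul_one]
    · fun_prop
  have hFL : ∀ n, eLpNorm (F n) 2 volume ≤ C₀ * (ENNReal.ofReal (D ^ n) * eLpNorm g 2 volume) := by
    intro n
    refine (h₀ (gk n) (hgk2 n) (hgksupp n)).trans ?_
    gcongr
    refine (eLpNorm_mono (g := fun ξ => ((D ^ n : ℝ) : ℂ) * g ξ) (hgkle n)).trans_eq ?_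
    rw [show (fun ξ => ((D ^ n : ℝ) : ℂ) * g ξ) = ((D ^ n : ℝ) : ℂ) • g from rfl,
      eLpNorm_const_smul, ← ofReal_norm, Complex.norm_real, Real.norm_of_nonneg (by positivity)]
  have hpt : ∀ x, maxEvol a γ g x ≤ ∑' n : ℕ, ENNReal.ofReal (2 ^ n / n.factorial) * ‖F n x‖ₑ := by
    intro x
    refine iSup₂_le fun t ht => ?_
    set w : ℂ := Complex.I * t - ((t ^ γ : ℝ) : ℂ) with hw
    have hw2 : ‖w‖ ≤ 2 := by
      refine (norm_sub_le _ _).trans ?_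
      rw [norm_mul, Complex.norm_I, one_mul, Complex.norm_real, Complex.norm_real,
        Real.norm_of_nonneg ht.1.le, Real.norm_of_nonneg (Real.rpow_nonneg ht.1.le _)]
      have := Real.rpow_le_one ht.1.le ht.2.le hγ.le
      linarith [ht.2]
    set T : ℕ → ℝ → ℂ := fun n ξ =>
      (w ^ n / n.factorial) * (gk n ξ * Complex.exp (Complex.I * x * ξ)) with hT
    have hTi : ∀ n, Integrable (T n) := fun n => by
      refine Integrable.const_mul ((hgk1 n).mono ((hgkm n).mul (by fun_prop))
        (Filter.Eventually.of_forall fun ξ => ?_)) _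
      rw [Pi.mul_apply, norm_mul, norm_exp_I_mul_mul, mul_one]
    have hTn : ∀ n ξ, ‖T n ξ‖ ≤ (2 * D) ^ n / n.factorial * ‖g ξ‖ := by
      intro n ξ
      have h1 := hgkle n ξ
      rw [norm_mul ((D ^ n : ℝ) : ℂ), Complex.norm_real,
        Real.norm_of_nonneg (by positivity : 0 ≤ D ^ n)] at h1
      rw [hT]
      simp only
      rw [norm_mul, norm_mul, norm_exp_I_mul_mul, mul_one, norm_div, norm_pow, Complex.norm_natCast]
      calc _ ≤ 2 ^ n / (n.factorial : ℝ) * (D ^ n * ‖g ξ‖) :=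
            mul_le_mul (by gcongr) h1 (norm_nonneg _) (by positivity)
        _ = _ := by rw [mul_pow]; ring
    have hTs : Summable fun n => ∫ ξ, ‖T n ξ‖ := by
      refine Summable.of_nonneg_of_le (fun n => integral_nonneg fun ξ => norm_nonneg _)
        (fun n => ?_) ((Real.summable_pow_div_factorial (2 * D)).mul_right (∫ ξ, ‖g ξ‖))
      rw [← integral_const_mul]
      exact integral_mono (hTi n).norm (hg.norm.const_mul _) (hTn n)
    have hsum := hasSum_integral_of_summable_integral_norm hTi hTs
    have e1 : (∫ ξ, ∑' n, T n ξ) = evol a γ g t x := by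
      unfold evol
      congr 1
      funext ξ
      have h := (NormedSpace.expSeries_div_hasSum_exp (𝔸 := ℂ) (w * ((|ξ| ^ a : ℝ) : ℂ)))
      rw [← Complex.exp_eq_exp_ℂ] at h
      have h' := (h.mul_right (g ξ * Complex.exp (Complex.I * x * ξ))).tsum_eq
      rw [symb, ← hw]
      calc _ = ∑' n : ℕ, (w * ((|ξ| ^ a : ℝ) : ℂ)) ^ n / n.factorial *
            (g ξ * Complex.exp (Complex.I * x * ξ)) := by
            congr 1
            funext n
            simp only [hT, hgk]
            push_cast
            rw [mul_pow]
            ring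
        _ = _ := by rw [h']; ring
    rw [e1] at hsum
    rw [← hsum.tsum_eq]
    refine (enorm_tsum_le_tsum_enorm).trans (ENNReal.tsum_le_tsum fun n => ?_)
    simp only [hT]
    rw [integral_const_mul, enorm_mul]
    gcongr
    rw [← ofReal_norm, norm_div, norm_pow, Complex.norm_natCast]
    gcongr
  calc eLpNorm (maxEvol a γ g) 2 volume
      ≤ eLpNorm (fun x => ∑' n : ℕ, ENNReal.ofReal (2 ^ n / n.factorial) * ‖F n x‖ₑ) 2 volume :=
        eLpNorm_mono_enorm fun x => by simpa only [enorm_eq_self] using hpt x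
    _ ≤ ∑' n : ℕ, eLpNorm (fun x => ENNReal.ofReal (2 ^ n / n.factorial) * ‖F n x‖ₑ) 2 volume :=
        eLpNorm_two_tsum_le fun n => (hFc n).enorm.measurable.const_mul _
    _ ≤ ∑' n : ℕ, C₀ * eLpNorm g 2 volume * ENNReal.ofReal ((2 * D) ^ n / n.factorial) := by
        refine ENNReal.tsum_le_tsum fun n => ?_
        have e : eLpNorm (fun x => ENNReal.ofReal (2 ^ n / n.factorial) * ‖F n x‖ₑ) 2 volume
            = ENNReal.ofReal (2 ^ n / n.factorial) * eLpNorm (F n) 2 volume := by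
          rw [eLpNorm_two_eq, eLpNorm_two_eq]
          simp_rw [enorm_eq_self, mul_pow]
          rw [lintegral_const_mul' _ _ (by simp), ENNReal.mul_rpow_of_nonneg _ _ (by norm_num),
            ← ENNReal.rpow_natCast, ← ENNReal.rpow_mul]
          norm_num
        rw [e]
        calc _ ≤ ENNReal.ofReal (2 ^ n / n.factorial) *
              (C₀ * (ENNReal.ofReal (D ^ n) * eLpNorm g 2 volume)) := by gcongr; exact hFL n
          _ = C₀ * eLpNorm g 2 volume *
              (ENNReal.ofReal (2 ^ n / n.factorial) * ENNReal.ofReal (D ^ n)) := by ring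
          _ = _ := by
            rw [← ENNReal.ofReal_mul (by positivity), mul_pow]
            congr 2
            ring
    _ = C₀ * eLpNorm g 2 volume * ENNReal.ofReal (Real.exp (2 * D)) := by
        rw [ENNReal.tsum_mul_left, ← ENNReal.ofReal_tsum_of_nonneg (fun n => by positivity)
          (Real.summable_pow_div_factorial _), Real.exp_eq_exp_ℝ,
          (NormedSpace.expSeries_div_hasSum_exp (𝔸 := ℝ) (2 * D)).tsum_eq]
    _ = _ := by
        rw [ENNReal.coe_mul]
        change _ = C₀ * ENNReal.ofReal _ * _
        ring

/-! ### Dyadic summation and sufficiency. -/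

theorem hat_eq_fourier_comp (f : 𝓢(ℝ, ℂ)) :
    hat f = fun ξ => (𝓕 f : 𝓢(ℝ, ℂ)) (ξ / (2 * Real.pi)) := by
  funext ξ
  rw [hat_eq_fourier, SchwartzMap.fourier_coe]

theorem integrable_hat (f : 𝓢(ℝ, ℂ)) : Integrable (hat f) := by
  rw [hat_eq_fourier_comp]
  exact (𝓕 f : 𝓢(ℝ, ℂ)).integrable.comp_div (by positivity)

theorem memLp_hat (f : 𝓢(ℝ, ℂ)) : MemLp (hat f) 2 volume := by
  rw [memLp_two_iff_integrable_sq_norm (integrable_hat f).1, hat_eq_fourier_comp]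
  have h : MemLp (𝓕 f : 𝓢(ℝ, ℂ)) 2 volume := SchwartzMap.memLp _ 2 _
  exact ((memLp_two_iff_integrable_sq_norm h.1).1 h).comp_div
    (R := 2 * Real.pi) (by positivity)

theorem maxEvol_add_le {a γ : ℝ} {g₁ g₂ : ℝ → ℂ} (h₁ : Integrable g₁) (h₂ : Integrable g₂) (x : ℝ) :
    maxEvol a γ (g₁ + g₂) x ≤ maxEvol a γ g₁ x + maxEvol a γ g₂ x := by
  refine iSup₂_le fun t ht => ?_
  have hi : ∀ g : ℝ → ℂ, Integrable g →
      Integrable fun ξ => g ξ * (symb a γ t ξ * Complex.exp (Complex.I * x * ξ)) := by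
    intro g hg
    have h1 : Measurable fun ξ => symb a γ t ξ :=
      (measurable_symb a γ).comp (measurable_const.prodMk measurable_id)
    refine hg.mono (hg.1.mul (h1.mul (by fun_prop)).aestronglyMeasurable)
      (Filter.Eventually.of_forall fun ξ => ?_)
    rw [norm_mul, norm_mul, norm_exp_I_mul_mul, mul_one]
    exact mul_le_of_le_one_right (norm_nonneg _) (norm_symb_le ht.1 ξ)
  have e : evol a γ (g₁ + g₂) t x = evol a γ g₁ t x + evol a γ g₂ t x := by
    unfold evol
    rw [← integral_add (hi g₁ h₁) (hi g₂ h₂)]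
    simp only [Pi.add_apply, add_mul]
  rw [e]
  exact (enorm_add_le _ _).trans (add_le_add
    (le_iSup₂ (f := fun t _ => ‖evol a γ g₁ t x‖ₑ) t ht)
    (le_iSup₂ (f := fun t _ => ‖evol a γ g₂ t x‖ₑ) t ht))

/-- The maximal estimate for frequencies in a dyadic annulus. -/
theorem exists_eLpNorm_maxEvol_annulus_le {a γ : ℝ} (ha : 1 < a) (hγ : 0 < γ) :
    ∃ C : ℝ, 0 < C ∧ ∀ N : ℝ, 1 ≤ N → ∀ g : ℝ → ℂ, Integrable g → MemLp g 2 volume →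
      (∀ ξ, g ξ ≠ 0 → |ξ| ∈ Ico (3 / 2 * N) (3 * N)) →
      eLpNorm (maxEvol a γ g) 2 volume ≤
        ENNReal.ofReal (C * N ^ (1 / 4 * a * max 0 (1 - 1 / γ))) * eLpNorm g 2 volume := by
  obtain ⟨C, hC, h⟩ := exists_lintegral_iSup_evol_le ha hγ
  refine ⟨2 * √C, by positivity, fun N hN g hg hg2 hsupp => ?_⟩
  set σ : ℝ := 1 / 4 * a * max 0 (1 - 1 / γ) with hσ
  have hN0 : 0 < N := by linarith
  have hσ0 : 0 ≤ σ := by rw [hσ]; have := le_max_left 0 (1 - 1 / γ); positivity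
  have hhalf : ∀ c : ℝ, |c| = N → ∀ g : ℝ → ℂ, Integrable g → MemLp g 2 volume →
      (∀ ξ, g ξ ≠ 0 → ξ / c ∈ Ico (3 / 2 : ℝ) 3) →
      eLpNorm (maxEvol a γ g) 2 volume ≤ ENNReal.ofReal (√C * N ^ σ) * eLpNorm g 2 volume := by
    intro c hc g hg hg2 hs
    refine le_of_sq_le_sq_ennreal ?_
    rw [mul_pow, eLpNorm_two_sq, eLpNorm_two_sq]
    refine (h c (abs_pos.1 (hc ▸ hN0)) g hg hg2 hs).trans ?_
    rw [← ENNReal.ofReal_pow (by positivity), hc]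
    gcongr
    rw [mul_pow, Real.sq_sqrt hC.le]
    gcongr
    -- `√(max 1 B) ≤ (N^σ)²` amounts to `max 1 B ≤ N^{4σ}`, and `4σ = a (1 - 1/γ)^+`.
    rw [Real.sqrt_le_left (by positivity), ← pow_mul, ← Real.rpow_mul_natCast hN0.le]
    refine max_le (Real.one_le_rpow hN (by positivity))
      (Real.rpow_le_rpow_of_exponent_le hN ?_)
    have := le_max_right 0 (1 - 1 / γ)
    rw [hσ]
    push_cast
    nlinarith
  have hsplit : g = (Ici 0).indicator g + (Ici 0)ᶜ.indicator g :=
    (indicator_self_add_compl _ _).symm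
  have hi1 : Integrable ((Ici 0).indicator g) := hg.indicator measurableSet_Ici
  have hi2 : Integrable ((Ici 0)ᶜ.indicator g) := hg.indicator measurableSet_Ici.compl
  have hn1 : eLpNorm ((Ici 0).indicator g) 2 volume ≤ eLpNorm g 2 volume := eLpNorm_indicator_le _
  have hn2 : eLpNorm ((Ici 0)ᶜ.indicator g) 2 volume ≤ eLpNorm g 2 volume := eLpNorm_indicator_le _
  have b1 := hhalf N (abs_of_pos hN0) _ hi1 (hg2.indicator measurableSet_Ici) fun ξ hξ => by
    have h1 : ξ ∈ Ici (0 : ℝ) := mem_of_indicator_ne_zero hξ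
    have h2 := hsupp ξ (by rwa [indicator_of_mem h1] at hξ)
    rw [abs_of_nonneg h1] at h2
    exact ⟨(le_div_iff₀ hN0).2 h2.1, (div_lt_iff₀ hN0).2 h2.2⟩
  have b2 := hhalf (-N) (by rw [abs_neg, abs_of_pos hN0]) _ hi2
    (hg2.indicator measurableSet_Ici.compl) fun ξ hξ => by
    have h1 : ξ ∈ (Ici (0 : ℝ))ᶜ := mem_of_indicator_ne_zero hξ
    have h2 := hsupp ξ (by rwa [indicator_of_mem h1] at hξ)
    rw [mem_compl_iff, mem_Ici, not_le] at h1
    rw [abs_of_neg h1] at h2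
    rw [div_neg, ← neg_div]
    exact ⟨(le_div_iff₀ hN0).2 h2.1, (div_lt_iff₀ hN0).2 h2.2⟩
  calc eLpNorm (maxEvol a γ g) 2 volume
      ≤ eLpNorm (maxEvol a γ ((Ici 0).indicator g) + maxEvol a γ ((Ici 0)ᶜ.indicator g)) 2
          volume := by
        refine eLpNorm_mono_enorm fun x => ?_
        simp only [enorm_eq_self]
        conv_lhs => rw [hsplit]
        exact maxEvol_add_le hi1 hi2 x
    _ ≤ _ := eLpNorm_add_le (measurable_maxEvol hi1).aestronglyMeasurable
        (measurable_maxEvol hi2).aestronglyMeasurable (by norm_num)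
    _ ≤ ENNReal.ofReal (√C * N ^ σ) * eLpNorm g 2 volume
        + ENNReal.ofReal (√C * N ^ σ) * eLpNorm g 2 volume :=
        add_le_add (b1.trans (by gcongr)) (b2.trans (by gcongr))
    _ = _ := by
        rw [← two_mul, ← mul_assoc, mul_assoc 2 (√C), ENNReal.ofReal_mul (by norm_num : (0 : ℝ) ≤ 2)]
        simp

/-- The end points of the dyadic annuli. -/
noncomputable def dyadicRadius : ℕ → ℝ
  | 0 => 0
  | n + 1 => 3 / 2 * 2 ^ n

theorem monotone_dyadicRadius : Monotone dyadicRadius := by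
  refine monotone_nat_of_le_succ fun n => ?_
  cases n with
  | zero => norm_num [dyadicRadius]
  | succ n =>
    simp only [dyadicRadius]
    rw [pow_succ]
    have : (0 : ℝ) < 2 ^ n := by positivity
    linarith

/-- The dyadic annuli in frequency space. -/
def annulus (n : ℕ) : Set ℝ := abs ⁻¹' Ico (dyadicRadius n) (dyadicRadius (n + 1))

theorem measurableSet_annulus (n : ℕ) : MeasurableSet (annulus n) :=
  measurable_norm (α := ℝ) measurableSet_Ico

theorem pairwise_disjoint_annulus : Pairwise (Function.onFun Disjoint annulus) := fun _ _ hij =>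
  (monotone_dyadicRadius.pairwise_disjoint_on_Ico_succ hij).preimage _

theorem iUnion_annulus : ⋃ n, annulus n = univ := by
  refine eq_univ_of_forall fun ξ => mem_iUnion.2 ?_
  have hex : ∃ n, |ξ| < dyadicRadius n := by
    obtain ⟨n, hn⟩ := pow_unbounded_of_one_lt |ξ| (by norm_num : (1 : ℝ) < 2)
    refine ⟨n + 1, ?_⟩
    simp only [dyadicRadius]
    linarith [abs_nonneg ξ]
  classical
  have h1 := Nat.find_spec hex
  cases hn : Nat.find hex with
  | zero =>
    rw [hn] at h1
    exact absurd h1 (not_lt.2 (abs_nonneg ξ))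
  | succ n =>
    rw [hn] at h1
    exact ⟨n, not_lt.1 (Nat.find_min hex (by omega : n < Nat.find hex)), h1⟩

theorem maxEvol_le_tsum_annulus {a γ : ℝ} {g : ℝ → ℂ} (hg : Integrable g) (x : ℝ) :
    maxEvol a γ g x ≤ ∑' n, maxEvol a γ ((annulus n).indicator g) x := by
  refine iSup₂_le fun t ht => ?_
  set w : ℝ → ℂ := fun ξ => symb a γ t ξ * Complex.exp (Complex.I * x * ξ) with hw
  have hi : Integrable fun ξ => g ξ * w ξ := by
    have h1 : Measurable fun ξ => symb a γ t ξ :=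
      (measurable_symb a γ).comp (measurable_const.prodMk measurable_id)
    refine hg.mono (hg.1.mul (h1.mul (by fun_prop)).aestronglyMeasurable)
      (Filter.Eventually.of_forall fun ξ => ?_)
    rw [norm_mul, hw, norm_mul, norm_exp_I_mul_mul, mul_one]
    exact mul_le_of_le_one_right (norm_nonneg _) (norm_symb_le ht.1 ξ)
  have h := hasSum_integral_iUnion measurableSet_annulus pairwise_disjoint_annulus
    (hi.integrableOn (s := ⋃ n, annulus n))
  rw [iUnion_annulus, setIntegral_univ] at h
  have e : ∀ n, ∫ ξ in annulus n, g ξ * w ξ = evol a γ ((annulus n).indicator g) t x := by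
    intro n
    rw [← integral_indicator (measurableSet_annulus n)]
    unfold evol
    congr 1
    funext ξ
    by_cases hξ : ξ ∈ annulus n <;> simp [hξ, hw]
  simp_rw [e] at h
  change ‖∫ ξ, g ξ * w ξ‖ₑ ≤ _
  rw [← h.tsum_eq]
  refine enorm_tsum_le_tsum_enorm.trans (ENNReal.tsum_le_tsum fun n => ?_)
  exact le_iSup₂ (f := fun t _ => ‖evol a γ ((annulus n).indicator g) t x‖ₑ) t ht

theorem eLpNorm_indicator_hat_le {s N : ℝ} (hs : 0 ≤ s) (hN : 0 < N) (f : 𝓢(ℝ, ℂ)) {S : Set ℝ}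
    (hS : ∀ ξ ∈ S, N ≤ √(1 + ξ ^ 2)) :
    eLpNorm (S.indicator (hat f)) 2 volume ≤ ENNReal.ofReal (N ^ (-s)) * sobolevNorm s f := by
  have e : ENNReal.ofReal (N ^ (-s)) * sobolevNorm s f = eLpNorm (((N ^ (-s) : ℝ) : ℂ) •
      fun ξ : ℝ => (((1 + ξ ^ 2) ^ (s / 2) : ℝ) : ℂ) * hat f ξ) 2 volume := by
    rw [eLpNorm_const_smul, ← ofReal_norm, Complex.norm_real, Real.norm_of_nonneg (by positivity),
      sobolevNorm]
  rw [e]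
  refine eLpNorm_mono fun ξ => ?_
  by_cases hξ : ξ ∈ S
  · rw [indicator_of_mem hξ, Pi.smul_apply, smul_eq_mul, norm_mul, norm_mul, Complex.norm_real,
      Complex.norm_real, Real.norm_of_nonneg (by positivity), Real.norm_of_nonneg (by positivity),
      ← mul_assoc]
    refine le_mul_of_one_le_left (norm_nonneg _) ?_
    rw [Real.rpow_neg hN.le, ← div_eq_inv_mul, one_le_div (by positivity)]
    calc N ^ s ≤ √(1 + ξ ^ 2) ^ s := Real.rpow_le_rpow hN.le (hS ξ hξ) hs
      _ = _ := by rw [Real.sqrt_eq_rpow, ← Real.rpow_mul (by positivity)]; ring_nf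
  · rw [indicator_of_notMem hξ, norm_zero]
    exact norm_nonneg _

/-- Sufficiency: the maximal estimate above the critical regularity. -/
theorem maximalEstimate_of_lt {a γ s : ℝ} (ha : 1 < a) (hγ : 0 < γ)
    (hs : 1 / 4 * a * max 0 (1 - 1 / γ) < s) : MaximalEstimate a γ s := by
  set σ : ℝ := 1 / 4 * a * max 0 (1 - 1 / γ) with hσ
  have hσ0 : 0 ≤ σ := by rw [hσ]; have := le_max_left 0 (1 - 1 / γ); positivity
  have hs0 : 0 < s := lt_of_le_of_lt hσ0 hs
  obtain ⟨C₀, h₀⟩ := exists_eLpNorm_maxEvol_low_le ha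
  obtain ⟨C₁, hC₁, h₁⟩ := exists_eLpNorm_maxEvol_annulus_le ha hγ
  -- Annulus `n + 1` costs `2^{nσ}` in the maximal estimate and gains `2^{-ns}` from the Sobolev
  -- weight. The strict inequality `σ < s` gives `ρ < 1`.
  set ρ : ℝ := 2 ^ (σ - s) with hρ
  have hρ0 : 0 < ρ := by positivity
  have hρ1 : ρ < 1 := Real.rpow_lt_one_of_one_lt_of_neg (by norm_num) (by linarith)
  have hsum : Summable fun n : ℕ => C₁ * ρ ^ n :=
    (summable_geometric_of_lt_one hρ0.le hρ1).mul_left _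
  refine ⟨C₀ + (∑' n : ℕ, C₁ * ρ ^ n).toNNReal, fun f => ?_⟩
  have hH := integrable_hat f
  have hH2 := memLp_hat f
  have hi : ∀ n, Integrable ((annulus n).indicator (hat f)) := fun n =>
    hH.indicator (measurableSet_annulus n)
  have hi2 : ∀ n, MemLp ((annulus n).indicator (hat f)) 2 volume := fun n =>
    hH2.indicator (measurableSet_annulus n)
  have hsupp : ∀ n ξ, (annulus n).indicator (hat f) ξ ≠ 0 → ξ ∈ annulus n := fun n ξ h =>
    mem_of_indicator_ne_zero h
  have hmax : maximalP a γ f = maxEvol a γ (hat f) := by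
    funext x
    unfold maximalP maxEvol
    simp_rw [P_eq_evol]
  have low : eLpNorm (maxEvol a γ ((annulus 0).indicator (hat f))) 2 volume
      ≤ C₀ * sobolevNorm s f := by
    refine (h₀ γ hγ _ (hi 0) (hi2 0) fun ξ hξ => ?_).trans ?_
    · have := (hsupp 0 ξ hξ).2
      simp only [dyadicRadius] at this
      linarith
    · gcongr
      refine (eLpNorm_indicator_hat_le hs0.le one_pos f fun ξ _ => ?_).trans_eq (by simp)
      exact Real.one_le_sqrt.2 (by nlinarith [sq_nonneg ξ])
  have high : ∀ n : ℕ, eLpNorm (maxEvol a γ ((annulus (n + 1)).indicator (hat f))) 2 volume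
      ≤ ENNReal.ofReal (C₁ * ρ ^ n) * sobolevNorm s f := by
    intro n
    have hN : (1 : ℝ) ≤ 2 ^ n := one_le_pow₀ (by norm_num)
    refine (h₁ (2 ^ n) hN _ (hi _) (hi2 _) fun ξ hξ => ?_).trans ?_
    · have := hsupp (n + 1) ξ hξ
      refine ⟨this.1, this.2.trans_eq ?_⟩
      simp only [dyadicRadius]
      rw [pow_succ]; ring
    · have h2 := eLpNorm_indicator_hat_le (N := 2 ^ n) (S := annulus (n + 1)) hs0.le
        (by positivity) f fun ξ hξ => by
          refine Real.le_sqrt_of_sq_le ?_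
          have h3 : (3 / 2 : ℝ) * 2 ^ n ≤ |ξ| := hξ.1
          rw [← sq_abs ξ]
          nlinarith
      refine (mul_le_mul_right h2 _).trans_eq ?_
      rw [← mul_assoc, ← ENNReal.ofReal_mul (by positivity), mul_assoc,
        ← Real.rpow_add (by positivity), ← sub_eq_add_neg, hρ, ← Real.rpow_natCast 2 n,
        ← Real.rpow_natCast (2 ^ (σ - s)) n, ← Real.rpow_mul (by norm_num),
        ← Real.rpow_mul (by norm_num), mul_comm (n : ℝ)]
  rw [hmax]
  calc eLpNorm (maxEvol a γ (hat f)) 2 volume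
      ≤ eLpNorm (fun x => ∑' n, maxEvol a γ ((annulus n).indicator (hat f)) x) 2 volume :=
        eLpNorm_mono_enorm fun x => by simpa only [enorm_eq_self] using maxEvol_le_tsum_annulus hH x
    _ ≤ ∑' n, eLpNorm (maxEvol a γ ((annulus n).indicator (hat f))) 2 volume :=
        eLpNorm_two_tsum_le fun n => measurable_maxEvol (hi n)
    _ = eLpNorm (maxEvol a γ ((annulus 0).indicator (hat f))) 2 volume +
        ∑' n, eLpNorm (maxEvol a γ ((annulus (n + 1)).indicator (hat f))) 2 volume :=
        tsum_eq_zero_add' ENNReal.summable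
    _ ≤ C₀ * sobolevNorm s f + ∑' n : ℕ, ENNReal.ofReal (C₁ * ρ ^ n) * sobolevNorm s f :=
        add_le_add low (ENNReal.tsum_le_tsum high)
    _ = _ := by
        rw [ENNReal.tsum_mul_right, ← ENNReal.ofReal_tsum_of_nonneg (fun n => by positivity) hsum,
          ← add_mul, ENNReal.coe_add]
        rfl

/-! ### Necessity: wave packets. -/

/-- A second order Taylor bound for powers. -/
theorem exists_abs_one_add_rpow_sub_le {a : ℝ} (ha : 1 < a) :
    ∃ K, 1 ≤ K ∧ ∀ u : ℝ, |u| ≤ 1 / 2 → |(1 + u) ^ a - 1 - a * u| ≤ K * u ^ 2 := by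
  -- `4 · 2^a` bounds `(1 + v)^{a-2}` for `|v| ≤ 1/2`: the numerator `(1 + v)^a` is at most `2^a`,
  -- and dividing by `(1 + v)²` costs at most 4.
  set K : ℝ := a * (a - 1) * (4 * 2 ^ a) with hK
  have hK0 : 0 ≤ K := by have : 0 < a - 1 := by linarith
                         positivity
  have hpos : ∀ u : ℝ, |u| ≤ 1 / 2 → 1 / 2 ≤ 1 + u := fun u hu => by linarith [(abs_le.1 hu).1]
  have h2 : ∀ u : ℝ, |u| ≤ 1 / 2 → |a * ((1 + u) ^ (a - 1) - 1)| ≤ K * |u| := by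
    intro u hu
    have hd : ∀ v ∈ Icc (-(1 / 2) : ℝ) (1 / 2), HasDerivWithinAt
        (fun v => a * ((1 + v) ^ (a - 1) - 1)) (a * ((a - 1) * (1 + v) ^ (a - 1 - 1)))
        (Icc (-(1 / 2) : ℝ) (1 / 2)) v := by
      intro v hv
      have hv' := hpos v (abs_le.2 hv)
      have := ((((hasDerivAt_id' v).const_add 1).rpow_const (p := a - 1)
        (Or.inl (by linarith))).sub_const 1).const_mul a
      exact (this.congr_deriv (by ring)).hasDerivWithinAt
    have hb : ∀ v ∈ Icc (-(1 / 2) : ℝ) (1 / 2), ‖a * ((a - 1) * (1 + v) ^ (a - 1 - 1))‖ ≤ K := by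
      intro v hv
      have hv' := hpos v (abs_le.2 hv)
      have h0 : 0 < 1 + v := by linarith
      have h1 : 0 < a - 1 := by linarith
      rw [Real.norm_of_nonneg (by positivity), hK, ← mul_assoc]
      gcongr
      rw [Real.rpow_sub_one h0.ne', Real.rpow_sub_one h0.ne', div_div, div_le_iff₀ (by positivity)]
      have h3 : (1 + v) ^ a ≤ 2 ^ a := Real.rpow_le_rpow h0.le (by linarith [hv.2]) (by linarith)
      have h4 : 1 ≤ 4 * ((1 + v) * (1 + v)) := by nlinarith
      have h5 : (0 : ℝ) < 2 ^ a := by positivity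
      nlinarith
    have := (convex_Icc (-(1 / 2) : ℝ) (1 / 2)).norm_image_sub_le_of_norm_hasDerivWithin_le hd hb
      (x := 0) (y := u) (by norm_num) (abs_le.1 hu)
    simpa using this
  refine ⟨K + 1, by linarith, fun u hu => ?_⟩
  have hd : ∀ v ∈ Icc (-|u|) |u|, HasDerivWithinAt
      (fun v => (1 + v) ^ a - 1 - a * v) (a * ((1 + v) ^ (a - 1) - 1)) (Icc (-|u|) |u|) v := by
    intro v hv
    have hv' := hpos v ((abs_le.2 hv).trans hu)
    have := ((((hasDerivAt_id' v).const_add 1).rpow_const (p := a)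
      (Or.inl (by linarith))).sub_const 1).sub ((hasDerivAt_id' v).const_mul a)
    exact (this.congr_deriv (by ring)).hasDerivWithinAt
  have hb : ∀ v ∈ Icc (-|u|) |u|, ‖a * ((1 + v) ^ (a - 1) - 1)‖ ≤ K * |u| := by
    intro v hv
    have hv' := abs_le.2 hv
    exact (h2 v (hv'.trans hu)).trans (by gcongr)
  have := (convex_Icc (-|u|) |u|).norm_image_sub_le_of_norm_hasDerivWithin_le hd hb
    (x := 0) (y := u) (by simp) ⟨neg_abs_le u, le_abs_self u⟩
  simp only [Real.norm_eq_abs, add_zero, Real.one_rpow, mul_zero, sub_zero, sub_self] at this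
  refine this.trans ?_
  rw [mul_assoc, ← sq, sq_abs]
  nlinarith [sq_nonneg u]

theorem abs_rpow_sub_taylor_le {a K N ξ : ℝ}
    (hK : ∀ u : ℝ, |u| ≤ 1 / 2 → |(1 + u) ^ a - 1 - a * u| ≤ K * u ^ 2)
    (hN : 0 < N) (hξ : |ξ - N| ≤ N / 2) :
    |ξ ^ a - N ^ a - a * N ^ (a - 1) * (ξ - N)| ≤ K * N ^ (a - 2) * (ξ - N) ^ 2 := by
  set u : ℝ := (ξ - N) / N with hu
  have hu2 : |u| ≤ 1 / 2 := by
    rw [hu, abs_div, abs_of_pos hN, div_le_iff₀ hN]; linarith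
  have hξu : ξ = N * (1 + u) := by rw [hu]; field_simp; ring
  have h1 : ξ - N = N * u := by rw [hξu]; ring
  have hNa : 0 < N ^ a := Real.rpow_pos_of_pos hN _
  have h2 : N ^ (a - 1) * N = N ^ a := by
    rw [Real.rpow_sub_one hN.ne']; field_simp
  have h3 : N ^ (a - 2) * N ^ 2 = N ^ a := by
    rw [← Real.rpow_natCast, ← Real.rpow_add hN]; norm_num
  have h4 : ξ ^ a = N ^ a * (1 + u) ^ a := by
    rw [hξu, Real.mul_rpow hN.le (by linarith [(abs_le.1 hu2).1])]
  have e1 : ξ ^ a - N ^ a - a * N ^ (a - 1) * (ξ - N) = N ^ a * ((1 + u) ^ a - 1 - a * u) := by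
    rw [h4, h1]; linear_combination (-a * u) * h2
  have e2 : K * N ^ (a - 2) * (ξ - N) ^ 2 = N ^ a * (K * u ^ 2) := by
    rw [h1]; linear_combination (K * u ^ 2) * h3
  rw [e1, e2, abs_mul, abs_of_pos hNa]
  exact mul_le_mul_of_nonneg_left (hK u hu2) hNa.le

/-- Smooth functions with compact support are Fourier transforms of Schwartz functions. -/
theorem exists_hat_eq {g : ℝ → ℝ} (hg : ContDiff ℝ (⊤ : ℕ∞) g) (hc : HasCompactSupport g) :
    ∃ f : 𝓢(ℝ, ℂ), ∀ ξ, hat f ξ = g ξ := by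
  have hpi : (2 * Real.pi) ≠ 0 := by positivity
  set G : ℝ → ℂ := fun η => ((g (2 * Real.pi * η) : ℝ) : ℂ) with hG
  have h1 : HasCompactSupport G := by
    have := hc.comp_homeomorph (Homeomorph.mulLeft₀ (2 * Real.pi) hpi)
    exact this.comp_left (g := ((↑) : ℝ → ℂ)) Complex.ofReal_zero
  have h2 : ContDiff ℝ (⊤ : ℕ∞) G :=
    Complex.ofRealCLM.contDiff.comp (hg.comp (contDiff_const.mul contDiff_id))
  refine ⟨𝓕⁻ (h1.toSchwartzMap h2), fun ξ => ?_⟩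
  rw [hat_eq_fourier, ← SchwartzMap.fourier_coe, FourierTransform.fourier_fourierInv_eq]
  change G _ = _
  rw [hG]
  simp only
  rw [mul_div_cancel₀ _ hpi]

/-- A wave packet moves without dispersion for short times. -/
theorem norm_P_ge {a γ K N r t x : ℝ} (ha : 1 < a)
    (hK : ∀ u : ℝ, |u| ≤ 1 / 2 → |(1 + u) ^ a - 1 - a * u| ≤ K * u ^ 2) (hK1 : 1 ≤ K)
    (hN : 1 ≤ N) (hr : 0 < r) (hrN : r ≤ N / 2) {b : ℝ → ℝ} (hb0 : ∀ ξ, 0 ≤ b ξ)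
    (hb1 : ∀ ξ, |ξ - N| ≤ r / 2 → b ξ = 1) (hbr : ∀ ξ, b ξ ≠ 0 → |ξ - N| ≤ r)
    {f : 𝓢(ℝ, ℂ)} (hf : ∀ ξ, hat f ξ = b ξ) (ht : 0 < t) (htN : t ^ γ * N ^ a ≤ 1)
    (htr : t * (K * N ^ (a - 2) * r ^ 2) ≤ 1) (hx : x = -(t * (a * N ^ (a - 1)))) :
    Real.cos 1 * Real.exp (-2 ^ a) * r ≤ ‖P a γ t f x‖ := by
  have hN0 : 0 < N := by linarith
  have htγ : 0 < t ^ γ := Real.rpow_pos_of_pos ht _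
  have hNa2 : 0 < N ^ (a - 2) := Real.rpow_pos_of_pos hN0 _
  have hcos : 0 < Real.cos 1 := Real.cos_one_pos
  -- `β` is the phase at the centre `N`. Once it is removed, the choice of `x` also kills the linear
  -- term, so Taylor's bound gives `|θ| ≤ 1` on the support of `b` and the integrand has real part
  -- with cosine at least `cos 1 > 0`. The inner interval where `b = 1` has length `r`; there `|ξ| ≤
  -- 2N`, so the damping is at least `e^{-2^a}`.
  set β : ℝ := t * N ^ a + x * N with hβ
  set θ : ℝ → ℝ := fun ξ => t * |ξ| ^ a + x * ξ - β with hθ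
  set w : ℝ → ℂ := fun ξ => hat f ξ * (symb a γ t ξ * Complex.exp (Complex.I * x * ξ)) with hw
  have hwi : Integrable w := by
    have hg := integrable_hat f
    have h1 : Measurable fun ξ => symb a γ t ξ :=
      (measurable_symb a γ).comp (measurable_const.prodMk measurable_id)
    refine hg.mono (hg.1.mul (h1.mul (by fun_prop)).aestronglyMeasurable)
      (Filter.Eventually.of_forall fun ξ => ?_)
    rw [hw, norm_mul, norm_mul, norm_exp_I_mul_mul, mul_one]
    exact mul_le_of_le_one_right (norm_nonneg _) (norm_symb_le ht ξ)
  set w' : ℝ → ℂ := fun ξ => Complex.exp (((-β : ℝ) : ℂ) * Complex.I) * w ξ with hw'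
  have hwi' : Integrable w' := hwi.const_mul _
  have hP : ‖P a γ t f x‖ = ‖∫ ξ, w' ξ‖ := by
    rw [P_eq_evol, hw', integral_const_mul, norm_mul, Complex.norm_exp_ofReal_mul_I, one_mul]
    rfl
  have hre : ∀ ξ, (w' ξ).re = b ξ * Real.exp (-(t ^ γ * |ξ| ^ a)) * Real.cos (θ ξ) := by
    intro ξ
    have : w' ξ = ((b ξ * Real.exp (-(t ^ γ * |ξ| ^ a)) : ℝ) : ℂ) *
        Complex.exp ((θ ξ : ℝ) * Complex.I) := by
      simp only [hw', hw, symb, hf]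
      rw [Complex.ofReal_mul, Complex.ofReal_exp, mul_assoc (b ξ : ℂ), ← Complex.exp_add,
        ← Complex.exp_add, mul_left_comm, ← Complex.exp_add]
      congr 2
      simp only [hθ]
      push_cast
      ring
    rw [this, Complex.re_ofReal_mul, Complex.exp_ofReal_mul_I_re]
  have hθb : ∀ ξ, |ξ - N| ≤ r → |θ ξ| ≤ 1 := by
    intro ξ hξ
    have hξ' := abs_le.1 hξ
    have hξ0 : 0 < ξ := by linarith
    have h1 := abs_rpow_sub_taylor_le hK hN0 (hξ.trans hrN)
    have e : θ ξ = t * (ξ ^ a - N ^ a - a * N ^ (a - 1) * (ξ - N)) := by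
      simp only [hθ, hβ, hx, abs_of_pos hξ0]; ring
    rw [e, abs_mul, abs_of_pos ht]
    refine le_trans (mul_le_mul_of_nonneg_left (h1.trans ?_) ht.le) htr
    have : (ξ - N) ^ 2 ≤ r ^ 2 := sq_le_sq' (by linarith) hξ'.2
    have hK0 : 0 ≤ K := by linarith
    gcongr
  have hcb : ∀ ξ, |ξ - N| ≤ r → Real.cos 1 ≤ Real.cos (θ ξ) := by
    intro ξ hξ
    rw [← Real.cos_abs (θ ξ)]
    exact Real.cos_le_cos_of_nonneg_of_le_pi (abs_nonneg _) (by linarith [Real.pi_gt_three])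
      (hθb ξ hξ)
  have hpt : ∀ ξ, (Icc (N - r / 2) (N + r / 2)).indicator
      (fun _ => Real.cos 1 * Real.exp (-2 ^ a)) ξ ≤ (w' ξ).re := by
    intro ξ
    rw [hre]
    by_cases hξ : ξ ∈ Icc (N - r / 2) (N + r / 2)
    · have h1 : |ξ - N| ≤ r / 2 := abs_le.2 ⟨by linarith [hξ.1], by linarith [hξ.2]⟩
      have hξ0 : 0 < ξ := by linarith [hξ.1]
      rw [indicator_of_mem hξ, hb1 ξ h1, one_mul, mul_comm]
      have h2 : t ^ γ * |ξ| ^ a ≤ 2 ^ a := by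
        rw [abs_of_pos hξ0]
        calc t ^ γ * ξ ^ a ≤ t ^ γ * (2 * N) ^ a := by
              gcongr
              linarith [hξ.2]
          _ = t ^ γ * N ^ a * 2 ^ a := by rw [Real.mul_rpow (by norm_num) hN0.le]; ring
          _ ≤ 1 * 2 ^ a := by gcongr
          _ = 2 ^ a := one_mul _
      exact mul_le_mul (Real.exp_le_exp.2 (by linarith)) (hcb ξ (by linarith)) hcos.le
        (Real.exp_pos _).le
    · rw [indicator_of_notMem hξ]
      by_cases hb : b ξ = 0
      · simp [hb]
      · have := hcb ξ (hbr ξ hb)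
        exact mul_nonneg (mul_nonneg (hb0 ξ) (Real.exp_pos _).le) (by linarith)
  have hint : ∫ ξ, (Icc (N - r / 2) (N + r / 2)).indicator
      (fun _ => Real.cos 1 * Real.exp (-2 ^ a)) ξ = Real.cos 1 * Real.exp (-2 ^ a) * r := by
    rw [integral_indicator measurableSet_Icc, setIntegral_const, Real.volume_real_Icc_of_le
      (by linarith), smul_eq_mul]
    ring
  rw [hP, ← hint]
  calc _ ≤ ∫ ξ, (w' ξ).re := integral_mono
        ((integrable_indicator_iff measurableSet_Icc).2 continuous_const.integrableOn_Icc) hwi'.re hpt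
    _ = (∫ ξ, w' ξ).re := integral_re hwi'
    _ ≤ _ := Complex.re_le_norm _

/-- The consequence of the maximal estimate for a single wave packet. -/
theorem exists_wave_packet_inequality {a γ s : ℝ} (ha : 1 < a) (hγ : 0 < γ) (hs : 0 < s)
    (h : MaximalEstimate a γ s) :
    ∃ K A : ℝ, 1 ≤ K ∧ ∀ N r t₀ : ℝ, 1 ≤ N → 0 < r → r ≤ N / 2 → 0 < t₀ → t₀ ≤ 1 →
      t₀ ^ γ * N ^ a ≤ 1 → t₀ * (K * N ^ (a - 2) * r ^ 2) ≤ 1 →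
      r * t₀ * N ^ (a - 1) ≤ A * N ^ (2 * s) := by
  obtain ⟨C, hC⟩ := h
  obtain ⟨K, hK1, hK⟩ := exists_abs_one_add_rpow_sub_le ha
  have hcos : 0 < Real.cos 1 := Real.cos_one_pos
  set κ : ℝ := Real.cos 1 * Real.exp (-2 ^ a) with hκ
  have hκ0 : 0 < κ := by positivity
  have ha0 : 0 < a := by linarith
  refine ⟨K, (C * 2 ^ s) ^ 2 * 2 / (κ ^ 2 * a), hK1, fun N r t₀ hN hr hrN ht0 ht1 htN htr => ?_⟩
  have hN0 : 0 < N := by linarith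
  have hNa1 : 0 < N ^ (a - 1) := Real.rpow_pos_of_pos hN0 _
  let b : ContDiffBump N := ⟨r / 2, r, by positivity, by linarith⟩
  have hbs : ∀ ξ, b ξ ≠ 0 → |ξ - N| ≤ r := by
    intro ξ hξ
    have : ξ ∈ Function.support b := hξ
    rw [b.support_eq, Metric.mem_ball, Real.dist_eq] at this
    exact this.le
  obtain ⟨f, hf⟩ := exists_hat_eq b.contDiff b.hasCompactSupport
  -- Each `x` is tested at the time when the packet, moving with speed `a N^{a-1}`, passes over it.
  have hlow : ∀ x ∈ Ioo (-(t₀ * (a * N ^ (a - 1)))) 0, ENNReal.ofReal (κ * r) ≤ maximalP a γ f x := by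
    intro x hx
    have hv : 0 < a * N ^ (a - 1) := by positivity
    set t : ℝ := -x / (a * N ^ (a - 1)) with ht
    have htpos : 0 < t := div_pos (by linarith [hx.2]) hv
    have htt : t ≤ t₀ := by rw [ht, div_le_iff₀ hv]; linarith [hx.1]
    have htt' : t < t₀ := by rw [ht, div_lt_iff₀ hv]; linarith [hx.1]
    have hb1 : ∀ ξ, |ξ - N| ≤ r / 2 → b ξ = 1 := fun ξ hξ =>
      b.one_of_mem_closedBall (by rw [Metric.mem_closedBall, Real.dist_eq]; exact hξ)
    have key := norm_P_ge (γ := γ) (t := t) (x := x) ha hK hK1 hN hr hrN (fun _ => b.nonneg)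
      hb1 hbs hf htpos
      (le_trans (by gcongr) htN) (le_trans (by gcongr) htr) (by rw [ht]; field_simp)
    calc ENNReal.ofReal (κ * r) ≤ ENNReal.ofReal ‖P a γ t f x‖ := ENNReal.ofReal_le_ofReal key
      _ = ‖P a γ t f x‖ₑ := ofReal_norm _
      _ ≤ _ := le_iSup₂ (f := fun t _ => ‖P a γ t f x‖ₑ) t ⟨htpos, by linarith⟩
  have hLHS : ENNReal.ofReal ((κ * r) ^ 2 * (t₀ * (a * N ^ (a - 1))))
      ≤ eLpNorm (maximalP a γ f) 2 volume ^ 2 := by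
    rw [eLpNorm_two_sq]
    calc _ = ∫⁻ _ in Ioo (-(t₀ * (a * N ^ (a - 1)))) 0, ENNReal.ofReal (κ * r) ^ 2 := by
          rw [setLIntegral_const, Real.volume_Ioo, ENNReal.ofReal_mul (by positivity),
            ENNReal.ofReal_pow (by positivity)]
          simp
      _ ≤ ∫⁻ x in Ioo (-(t₀ * (a * N ^ (a - 1)))) 0, ‖maximalP a γ f x‖ₑ ^ 2 := by
          refine setLIntegral_mono' measurableSet_Ioo fun x hx => ?_
          rw [enorm_eq_self]
          exact pow_le_pow_left' (hlow x hx) 2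
      _ ≤ _ := setLIntegral_le_lintegral _ _
  -- On the support `|ξ| ≤ 3N/2`, so `1 + ξ² ≤ (2N)²`; the support has length at most `2r`.
  have hRHS : sobolevNorm s f ^ 2 ≤ ENNReal.ofReal (((2 * N) ^ s) ^ 2 * (2 * r)) := by
    rw [sobolevNorm, eLpNorm_two_sq]
    calc _ ≤ ∫⁻ ξ, (Icc (N - r) (N + r)).indicator
            (fun _ => ENNReal.ofReal ((2 * N) ^ s) ^ 2) ξ := by
          refine lintegral_mono fun ξ => ?_
          dsimp only
          by_cases hb : b ξ = 0
          · rw [hf, hb]; simp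
          · have h1 := abs_le.1 (hbs ξ hb)
            have h2 : ξ ∈ Icc (N - r) (N + r) := ⟨by linarith, by linarith⟩
            rw [indicator_of_mem h2, ← ofReal_norm]
            gcongr
            rw [hf, norm_mul, Complex.norm_real, Complex.norm_real,
              Real.norm_of_nonneg (by positivity), Real.norm_of_nonneg b.nonneg]
            refine (mul_le_of_le_one_right (by positivity) b.le_one).trans ?_
            calc (1 + ξ ^ 2) ^ (s / 2) ≤ ((2 * N) ^ (2 : ℝ)) ^ (s / 2) := by
                  gcongr
                  rw [Real.rpow_two]
                  nlinarith
              _ = _ := by rw [← Real.rpow_mul (by positivity)]; ring_nf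
      _ = _ := by
          rw [lintegral_indicator measurableSet_Icc, setLIntegral_const, Real.volume_Icc,
            ENNReal.ofReal_mul (by positivity), ENNReal.ofReal_pow (by positivity)]
          congr 2
          ring
  have hmain : ENNReal.ofReal ((κ * r) ^ 2 * (t₀ * (a * N ^ (a - 1))))
      ≤ ENNReal.ofReal ((C : ℝ) ^ 2 * (((2 * N) ^ s) ^ 2 * (2 * r))) := by
    refine hLHS.trans ((pow_le_pow_left' (hC f) 2).trans ?_)
    rw [mul_pow, ENNReal.ofReal_mul (by positivity), ENNReal.ofReal_pow (by positivity),
      ENNReal.ofReal_coe_nnreal]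
    gcongr
  rw [ENNReal.ofReal_le_ofReal_iff (by positivity), Real.mul_rpow (by norm_num) hN0.le] at hmain
  have hNs : N ^ (2 * s) = (N ^ s) ^ 2 := by
    rw [← Real.rpow_mul_natCast hN0.le]; push_cast; ring_nf
  rw [hNs, div_mul_eq_mul_div, le_div_iff₀ (by positivity)]
  refine le_of_mul_le_mul_left ?_ hr
  linarith

/-- Necessity of the regularity. -/
theorem le_of_maximalEstimate {a γ s : ℝ} (ha : 1 < a) (hγ : 0 < γ) (hs : 0 < s)
    (h : MaximalEstimate a γ s) : 1 / 4 * a * max 0 (1 - 1 / γ) ≤ s := by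
  rcases le_or_gt (1 - 1 / γ) 0 with h0 | h0
  · rw [max_eq_left h0, mul_zero]; exact hs.le
  rw [max_eq_right h0.le]
  obtain ⟨K, A, hK, hA⟩ := exists_wave_packet_inequality ha hγ hs h
  have hK0 : 0 < K := by linarith
  -- This makes `K δ² = 1/(4K) ≤ 1`, as the dispersion condition requires, and `δ ≤ 1/2`, which
  -- gives `r ≤ N/2`.
  set δ : ℝ := 1 / (2 * K) with hδ
  have hδ0 : 0 < δ := by positivity
  by_contra! hlt
  set ε : ℝ := a / 2 * (1 - 1 / γ) - 2 * s with hε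
  have hε0 : 0 < ε := by rw [hε]; linarith
  have hbound : ∀ N : ℝ, 1 ≤ N → N ^ ε ≤ A / δ := by
    intro N hN
    have hN0 : 0 < N := by linarith
    -- With `t₀ = N^{-a/γ}`, the exponent `p` is the one for which `t₀ N^{a-2} N^{2p} = 1`: the
    -- widest frequency band without dispersion. Then `r t₀ N^{a-1} = δ N^{(a/2)(1-1/γ)}`, which
    -- exceeds `N^{2s}` by the factor `δ N^ε`.
    set p : ℝ := 1 - a / 2 * (1 - 1 / γ) with hp
    have hNp : 0 < N ^ p := Real.rpow_pos_of_pos hN0 _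
    have hpp : 0 < a / 2 * (1 - 1 / γ) := by positivity
    have h1 := hA N (δ * N ^ p) (N ^ (-(a / γ))) hN (by positivity) ?_ (by positivity) ?_ ?_ ?_
    · have e : δ * N ^ p * N ^ (-(a / γ)) * N ^ (a - 1) = δ * (N ^ ε * N ^ (2 * s)) := by
        rw [mul_assoc, mul_assoc, ← Real.rpow_add hN0, ← Real.rpow_add hN0, ← Real.rpow_add hN0]
        congr 2
        rw [hp, hε]; ring
      rw [e, ← mul_assoc] at h1
      have h2 := le_of_mul_le_mul_right h1 (Real.rpow_pos_of_pos hN0 _)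
      rw [le_div_iff₀ hδ0]; linarith
    · have h2 : N ^ p ≤ N ^ (1 : ℝ) := Real.rpow_le_rpow_of_exponent_le hN (by rw [hp]; linarith)
      rw [Real.rpow_one] at h2
      have h3 : δ ≤ 1 / 2 := by
        rw [hδ]
        exact one_div_le_one_div_of_le (by norm_num) (by linarith)
      calc δ * N ^ p ≤ 1 / 2 * N := by gcongr
        _ = N / 2 := by ring
    · refine Real.rpow_le_one_of_one_le_of_nonpos hN ?_
      rw [neg_nonpos]; positivity
    · rw [← Real.rpow_mul hN0.le, ← Real.rpow_add hN0]
      have : -(a / γ) * γ + a = 0 := by field_simp; ring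
      rw [this, Real.rpow_zero]
    · have e : N ^ (-(a / γ)) * (K * N ^ (a - 2) * (δ * N ^ p) ^ 2) = K * δ ^ 2 := by
        have e2 : (N ^ p) ^ 2 = N ^ (p * 2) := by
          rw [← Real.rpow_mul_natCast hN0.le]; norm_num
        have e3 : N ^ (-(a / γ)) * N ^ (a - 2) * N ^ (p * 2) = 1 := by
          rw [← Real.rpow_add hN0, ← Real.rpow_add hN0, ← Real.rpow_zero N]
          congr 1
          rw [hp]; ring
        rw [mul_pow, e2]
        linear_combination (K * δ ^ 2) * e3
      rw [e, hδ, div_pow, mul_pow, one_pow, mul_one_div, div_le_one (by positivity)]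
      nlinarith
  have ht := (tendsto_rpow_atTop hε0).eventually_gt_atTop (A / δ)
  obtain ⟨N, hN1, hN2⟩ := (ht.and (Filter.eventually_ge_atTop 1)).exists
  exact absurd (hbound N hN2) (not_le.2 hN1)

end ComplexTime

/-- In `ℝ` a greatest lower bound exists only for a non-empty set, since every real bounds the empty
set from below; so `IsGLB` includes the non-emptiness claim. -/
theorem theorem1p2 (a γ : ℝ) (ha : 1 < a) (hγ : 0 < γ) :
    IsGLB {s : ℝ | 0 < s ∧ ComplexTime.MaximalEstimate a γ s}
      (1 / 4 * a * max 0 (1 - 1 / γ)) := by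
  refine ⟨fun s hs => ComplexTime.le_of_maximalEstimate ha hγ hs.1 hs.2, fun b hb => ?_⟩
  refine le_of_forall_gt_imp_ge_of_dense fun s hs => hb ⟨lt_of_le_of_lt ?_ hs,
    ComplexTime.maximalEstimate_of_lt ha hγ hs⟩
  have := le_max_left 0 (1 - 1 / γ)
  positivity
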